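/- **Theorem 5.1** (centrally symmetric shuffling theorem). All regions are finite unions of unit triangles of the triangular lattice (with one family of lattice lines horizontal). A *lozenge* is the union of two unit triangles sharing an edge, and a *lozenge tiling* of a region $G$ is a set of non-overlapping lozenges whose union is $G$. Let $M(G)$ be the number of lozenge tilings of $G$; if $G$ is invariant under the rotation by $180^\circ$ about a point, let $M_\odot(G)$ be the number of lozenge tilings of $G$ that are invariant under this rotation. Let $a,b\ge 0$ be integers and $k=a+b$, $[k]=\{1,\dots,k\}$. For $S\subseteq[k]$ put $S_{(k)}=\{k+1-s : s\in S\}$ and $\Delta_1(S)=\prod_{s,s'\in S,\ s<s'}(s'-s)$. Let $V_{a,b,b}$ be the hexagon with side lengths $a,b,b,a,b,b$ (clockwise from the top, which is horizontal). Its horizontal diagonal has length $k$; label the unit segments on it by $1,\dots,k$ from left to right. Let $V(S)=V_{a,b,b}(S,S_{(k)})$ be the region obtained from $V_{a,b,b}$ by removing the up-pointing unit triangles whose bases are the segments labeled by $S$ and the down-pointing unit triangles whose bases are the segments labeled by $S_{(k)}$; it is invariant under the rotation by $180^\circ$ about the midpoint of the diagonal, and $M_\odot(V(S))$ refers to this rotation.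 Let $X\subseteq[k]$ satisfy $|[k]\setminus(X\cup X_{(k)})|\ \ge\ b-|X|\ \ge\ 0$, and let $X'$ be such that $(X',X'_{(k)})$ is a shuffling of $(X,X_{(k)})$, that is, $$X'\cup X'_{(k)}=X\cup X_{(k)},\qquad X'\cap X'_{(k)}=X\cap X_{(k)}.$$ Then $M(V(X))>0$, $$\sqrt{\frac{M(V(X'))}{M(V(X))}}=\frac{\Delta_1(X')}{\Delta_1(X)},\qquad M_\odot(V(X'))=\frac{\Delta_1(X')}{\Delta_1(X)}\,M_\odot(V(X)).$$ In particular, whenever $M_\odot(V(X))\neq 0$, $$\frac{M_\odot(V(X'))}{M_\odot(V(X))}=\sqrt{\frac{M(V(X'))}{M(V(X))}}=\frac{\Delta_1(X')}{\Delta_1(X)}.$$ -/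

import Mathlib

namespace LozengeShuffling

/-- The point with lattice coordinates `(x, y)` is `x • e₁ + y • e₂`, where `e₁` is the horizontal
unit vector pointing right and `e₂` is `e₁` rotated by `60°` counterclockwise. -/
abbrev LatticePoint := ℤ × ℤ

/-- A unit triangle of the triangular lattice, given by its horizontal edge, from `(x, y)` to
`(x + 1, y)`, and by its orientation: the triangle lies above this edge if `up = true`
(up-pointing) and below it if `up = false` (down-pointing). -/
structure UnitTriangle where
  x : ℤ
  y : ℤ
  up : Bool
deriving DecidableEq

/-- The three vertices of a unit triangle. -/
def UnitTriangle.vertices (t : UnitTriangle) : Finset LatticePoint :=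
  if t.up then {(t.x, t.y), (t.x + 1, t.y), (t.x, t.y + 1)}
  else {(t.x, t.y), (t.x + 1, t.y), (t.x + 1, t.y - 1)}

/-- Two distinct unit triangles are adjacent if they share an edge, i.e. two vertices. -/
def UnitTriangle.Adj (s t : UnitTriangle) : Prop :=
  s ≠ t ∧ (s.vertices ∩ t.vertices).card = 2

/-- A bounded region on the triangular lattice: a finite union of unit triangles, given as the
finite set of these triangles. -/
abbrev Region := Finset UnitTriangle

/-- A lozenge is the union of two adjacent unit triangles. -/
def IsLozenge (L : Region) : Prop :=
  ∃ s t : UnitTriangle, s.Adj t ∧ L = {s, t}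

/-- A lozenge tiling of `G`: a collection of non-overlapping lozenges whose union is `G`. -/
structure IsLozengeTiling (G : Region) (T : Finset Region) : Prop where
  lozenge : ∀ L ∈ T, IsLozenge L
  disjoint : ∀ L ∈ T, ∀ L' ∈ T, L ≠ L' → Disjoint L L'
  cover : T.biUnion id = G

open Classical in
/-- The finite set of all lozenge tilings of `G`. -/
noncomputable def lozengeTilings (G : Region) : Finset (Finset Region) :=
  G.powerset.powerset.filter (IsLozengeTiling G)

theorem mem_lozengeTilings {G : Region} {T : Finset Region} :
    T ∈ lozengeTilings G ↔ IsLozengeTiling G T := by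
  classical
  unfold lozengeTilings
  rw [Finset.mem_filter, and_iff_right_iff_imp]
  intro h
  rw [Finset.mem_powerset]
  intro L hL
  rw [Finset.mem_powerset, ← h.cover]
  exact Finset.subset_biUnion_of_mem id hL

/-- `M(G)`, the number of lozenge tilings of `G`. -/
noncomputable def tilingCount (G : Region) : ℕ := (lozengeTilings G).card

/-- Rotation by `180°` about the point `o / 2`, acting on the lattice points. -/
def rotatePoint (o : LatticePoint) (p : LatticePoint) : LatticePoint := o - p

/-- Rotation by `180°` about the point `o / 2`, acting on the unit triangles
(see `vertices_rotate`). -/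
def UnitTriangle.rotate (o : LatticePoint) (t : UnitTriangle) : UnitTriangle :=
  ⟨o.1 - t.x - 1, o.2 - t.y, !t.up⟩

theorem vertices_rotate (o : LatticePoint) (t : UnitTriangle) :
    (t.rotate o).vertices = t.vertices.image (rotatePoint o) := by
  obtain ⟨x, y, u⟩ := t
  obtain ⟨p, q⟩ := o
  ext ⟨v, w⟩
  cases u <;>
    simp [UnitTriangle.rotate, UnitTriangle.vertices, rotatePoint] <;> omega

/-- A region is centrally symmetric with center `o / 2` if it is invariant under the rotation by
`180°` about `o / 2`. -/
def IsCentrallySymmetric (o : LatticePoint) (G : Region) : Prop :=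
  G.image (UnitTriangle.rotate o) = G

/-- A tiling is centrally symmetric with center `o / 2` if the rotation by `180°` about `o / 2`
maps its set of lozenges to itself. -/
def IsCentrallySymmetricTiling (o : LatticePoint) (T : Finset Region) : Prop :=
  T.image (fun L => L.image (UnitTriangle.rotate o)) = T

open Classical in
/-- `M_⊙(G)`, the number of centrally symmetric lozenge tilings of `G`, a region that is centrally
symmetric with center `o / 2`. -/
noncomputable def symmetricTilingCount (o : LatticePoint) (G : Region) : ℕ :=
  ((lozengeTilings G).filter (IsCentrallySymmetricTiling o)).card

/-- The lattice points of the hexagon `V_{a,b,c}` (for `c ≤ a + b`) with side lengths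
`a, b, c, a + b - c, c, b`, clockwise from the top. Its horizontal diagonal is the segment from
`(0, 0)` to `(a + b, 0)`, and its six sides lie on the lines `y = b`, `x + y = a + b`, `x = a + b`,
`y = -c`, `x + y = 0`, `x = 0`, in the same order. -/
def InHexagon (a b c : ℕ) (p : LatticePoint) : Prop :=
  p.2 ≤ b ∧ p.1 + p.2 ≤ a + b ∧ p.1 ≤ a + b ∧ -(c : ℤ) ≤ p.2 ∧ 0 ≤ p.1 + p.2 ∧ 0 ≤ p.1

instance (a b c : ℕ) : DecidablePred (InHexagon a b c) := fun p => by
  unfold InHexagon; infer_instance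

/-- The hexagon `V_{a,b,c}` as a region (see `mem_hexagon`). -/
noncomputable def hexagon (a b c : ℕ) : Region :=
  ((Finset.Icc (0 : ℤ) (a + b) ×ˢ Finset.Icc (-(c : ℤ)) b ×ˢ (Finset.univ : Finset Bool)).image
    (fun q => (⟨q.1, q.2.1, q.2.2⟩ : UnitTriangle))).filter
      (fun t => ∀ p ∈ t.vertices, InHexagon a b c p)

theorem mem_hexagon {a b c : ℕ} {t : UnitTriangle} :
    t ∈ hexagon a b c ↔ ∀ p ∈ t.vertices, InHexagon a b c p := by
  unfold hexagon
  rw [Finset.mem_filter, and_iff_right_iff_imp]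
  intro h
  obtain ⟨x, y, u⟩ := t
  have h0 := h (x, y) (by cases u <;> simp [UnitTriangle.vertices])
  simp only [InHexagon] at h0
  simp only [Finset.mem_image, Finset.mem_product, Finset.mem_Icc, Finset.mem_univ, and_true]
  exact ⟨(x, y, u), ⟨⟨h0.2.2.2.2.2, h0.2.2.1⟩, h0.2.2.2.1, h0.1⟩, rfl⟩

/-- The up-pointing unit triangle whose base is the unit segment with label `s` on the horizontal
diagonal, i.e. the segment from `(s - 1, 0)` to `(s, 0)`. -/
def upAt (s : ℤ) : UnitTriangle := ⟨s - 1, 0, true⟩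

/-- The down-pointing unit triangle whose base is the unit segment with label `s` on the horizontal
diagonal. -/
def downAt (s : ℤ) : UnitTriangle := ⟨s - 1, 0, false⟩

/-- The region `V_{a,b,c}(X, Y)`: the hexagon with the up-pointing triangles at the labels in `X`
and the down-pointing triangles at the labels in `Y` removed. -/
noncomputable def dentedHexagon (a b c : ℕ) (X Y : Finset ℤ) : Region :=
  hexagon a b c \ (X.image upAt ∪ Y.image downAt)

/-- The set of labels `[k] = {1, …, k}`. -/
noncomputable def labels (k : ℕ) : Finset ℤ := Finset.Icc 1 (k : ℤ)

/-- `X_{(k)} = {k + 1 - x | x ∈ X}`. -/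
def reflect (k : ℕ) (X : Finset ℤ) : Finset ℤ := X.image (fun x => (k : ℤ) + 1 - x)

/-- `(X', Y')` is a shuffling of `(X, Y)`. -/
def IsShuffling (X' Y' X Y : Finset ℤ) : Prop :=
  X ∪ Y = X' ∪ Y' ∧ X ∩ Y = X' ∩ Y'

/-- `Δ₁(S)`, the product of `s' - s` over all `s, s' ∈ S` with `s < s'`. -/
def delta (S : Finset ℤ) : ℤ :=
  ∏ p ∈ (S ×ˢ S).filter (fun p => p.1 < p.2), (p.2 - p.1)

/-- The region `V_{a,b,b}(X, X_{(a+b)})`. -/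
noncomputable def symmetricRegion (a b : ℕ) (X : Finset ℤ) : Region :=
  dentedHexagon a b b X (reflect (a + b) X)

/-- Twice the midpoint of the horizontal diagonal, which is the center of
`V_{a,b,b}(X, X_{(a+b)})` (see `symmetricRegion_isCentrallySymmetric`). -/
def twiceCenter (a b : ℕ) : LatticePoint := ((a : ℤ) + b, 0)

theorem symmetricRegion_isCentrallySymmetric (a b : ℕ) (X : Finset ℤ) :
    IsCentrallySymmetric (twiceCenter a b) (symmetricRegion a b X) := by
  have inv : ∀ t : UnitTriangle,
      (t.rotate (twiceCenter a b)).rotate (twiceCenter a b) = t := by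
    rintro ⟨x, y, u⟩
    simp only [UnitTriangle.rotate, twiceCenter, Bool.not_not, UnitTriangle.mk.injEq]
    refine ⟨?_, ?_, trivial⟩ <;> ring
  have key : ∀ t ∈ symmetricRegion a b X,
      t.rotate (twiceCenter a b) ∈ symmetricRegion a b X := by
    intro t ht
    simp only [symmetricRegion, dentedHexagon, Finset.mem_sdiff, Finset.mem_union,
      Finset.mem_image, reflect, mem_hexagon, not_or, not_exists, not_and] at ht ⊢
    obtain ⟨h1, h2, h3⟩ := ht
    refine ⟨?_, ?_, ?_⟩
    · intro p hp
      rw [vertices_rotate, Finset.mem_image] at hp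
      obtain ⟨q, hq, rfl⟩ := hp
      have := h1 q hq
      simp only [InHexagon, rotatePoint, twiceCenter, Prod.fst_sub, Prod.snd_sub] at this ⊢
      omega
    · intro s hs h
      apply h3 _ ⟨s, hs, rfl⟩
      rw [← inv t, ← h]
      simp [upAt, downAt, UnitTriangle.rotate, twiceCenter]
      ring
    · rintro _ ⟨s, hs, rfl⟩ h
      apply h2 s hs
      rw [← inv t, ← h]
      simp [upAt, downAt, UnitTriangle.rotate, twiceCenter]
      ring
  unfold IsCentrallySymmetric
  ext t
  rw [Finset.mem_image]
  exact ⟨by rintro ⟨s, hs, rfl⟩; exact key s hs, fun h => ⟨_, key t h, inv t⟩⟩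

end LozengeShuffling

open LozengeShuffling

/-! Cut a tiling of V(X) along the horizontal diagonal, and let Z be the set of segments crossed by
its vertical lozenges; Z avoids U = X ∪ X_(k). What remains is a tiling of the upper half with dents
X ∪ Z and a tiling of the lower half, which the rotation turns into an upper half with dents X ∪
Z_(k). An upper half with dents S has Δ₁(S) / ∏_{i<b} i! tilings if |S| = b and none otherwise
(`tilingCount_dentedTrapezoid`).

Now Δ₁(X ∪ Z) = Δ₁(X) Δ₁(Z) ∏_{x∈X} ∏_{z∈Z} |x − z| (`delta_union`), and Δ₁(X ∪ Z_(k)) = Δ₁(X_(k) ∪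
Z) by reflection. Multiplying the two halves gives Δ₁(X)² Δ₁(Z)² times the distances from Z to X and
to X_(k), that is, to U and to I = X ∩ X_(k). Hence M(V(X)) is Δ₁(X)² times a factor depending only
on |X|, U and I (`tilingCount_symmetricRegion`), and 2|X| = |U| + |I|. The factor is positive
because the cardinality hypothesis leaves room for some Z with b − |X| elements
(`commonFactor_pos`).

A centrally symmetric tiling is determined by its upper half and has Z = Z_(k), so Δ₁(X) comes out
only once. For such Z the distances to X and to X_(k) have equal products, so the product over X is
the square root of the one over U and I and does not change under shuffling
(`IsShuffling.prod_distProd_eq`).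

The count for the upper half is by induction on its height. The bottom row has at most one tiling,
and it has one exactly when the dents S below and the crossings Z above interlace
(`tilingCount_dentedStrip`). Then m! ∑_Z Δ₁(Z) = Δ₁(S) (`sum_delta_interlaces`), which is a discrete
integration of a Vandermonde determinant. -/

namespace LozengeShuffling

open Finset

/-! ### Adjacency of unit triangles and the three kinds of lozenges -/

/-- The up-pointing unit triangle with base from `(s - 1, h)` to `(s, h)`. -/
def up (h s : ℤ) : UnitTriangle := ⟨s - 1, h, true⟩

/-- The down-pointing unit triangle with base from `(s - 1, h)` to `(s, h)`. -/
def down (h s : ℤ) : UnitTriangle := ⟨s - 1, h, false⟩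

theorem up_or_down (t : UnitTriangle) : (∃ h s, t = up h s) ∨ ∃ h s, t = down h s := by
  obtain ⟨x, y, u⟩ := t
  cases u
  · exact .inr ⟨y, x + 1, by simp [down]⟩
  · exact .inl ⟨y, x + 1, by simp [up]⟩

@[simp] theorem up_inj {h s h' s' : ℤ} : up h s = up h' s' ↔ h = h' ∧ s = s' := by
  simp [up, and_comm]

@[simp] theorem down_inj {h s h' s' : ℤ} : down h s = down h' s' ↔ h = h' ∧ s = s' := by
  simp [down, and_comm]

@[simp] theorem up_ne_down {h s h' s' : ℤ} : up h s ≠ down h' s' := by simp [up, down]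

@[simp] theorem down_ne_up {h s h' s' : ℤ} : down h s ≠ up h' s' := by simp [up, down]

theorem up_injective (h : ℤ) : Function.Injective (up h) := fun _ _ e => (up_inj.1 e).2

theorem down_injective (h : ℤ) : Function.Injective (down h) := fun _ _ e => (down_inj.1 e).2

theorem adj_comm {s t : UnitTriangle} : s.Adj t ↔ t.Adj s := by
  simp [UnitTriangle.Adj, inter_comm, ne_comm]

/-- Writing the cardinality as a sum of indicators reduces adjacency to a case split in linear
integer arithmetic. -/
theorem card_inter_triple {p q r : LatticePoint} (hpq : p ≠ q) (hpr : p ≠ r) (hqr : q ≠ r)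
    (A : Finset LatticePoint) : (({p, q, r} : Finset LatticePoint) ∩ A).card =
      (if p ∈ A then 1 else 0) + ((if q ∈ A then 1 else 0) + (if r ∈ A then 1 else 0)) := by
  rw [← filter_mem_eq_inter, card_filter, sum_insert (by simp [hpq, hpr]),
    sum_insert (by simp [hqr]), sum_singleton]

theorem adj_up_down {h s h' s' : ℤ} : (up h s).Adj (down h' s') ↔
    (h' = h ∧ s' = s) ∨ (h' = h + 1 ∧ s' = s) ∨ (h' = h + 1 ∧ s' = s - 1) := by
  simp only [UnitTriangle.Adj, ne_eq, up_ne_down, not_false_eq_true, true_and]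
  simp only [UnitTriangle.vertices, up, down, if_true, Bool.false_eq_true, if_false]
  rw [card_inter_triple (by simp) (by simp) (by simp)]
  simp only [mem_insert, mem_singleton, Prod.mk.injEq]
  split_ifs <;> omega

theorem not_adj_up_up {h s h' s' : ℤ} : ¬(up h s).Adj (up h' s') := by
  simp only [UnitTriangle.Adj, ne_eq, up_inj]
  simp only [UnitTriangle.vertices, up, if_true]
  rw [card_inter_triple (by simp) (by simp) (by simp)]
  simp only [mem_insert, mem_singleton, Prod.mk.injEq]
  split_ifs <;> omega

theorem not_adj_down_down {h s h' s' : ℤ} : ¬(down h s).Adj (down h' s') := by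
  simp only [UnitTriangle.Adj, ne_eq, down_inj]
  simp only [UnitTriangle.vertices, down, Bool.false_eq_true, if_false]
  rw [card_inter_triple (by simp) (by simp) (by simp; omega)]
  simp only [mem_insert, mem_singleton, Prod.mk.injEq]
  split_ifs <;> omega

/-- The vertical lozenge whose horizontal diagonal goes from `(s - 1, h)` to `(s, h)`. -/
def vert (h s : ℤ) : Region := {up h s, down h s}

/-- The lozenge consisting of `up h s` and its upper right neighbor. -/
def rightLozenge (h s : ℤ) : Region := {up h s, down (h + 1) s}

/-- The lozenge consisting of `up h s` and its upper left neighbor. -/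
def leftLozenge (h s : ℤ) : Region := {up h s, down (h + 1) (s - 1)}

/-- Adjacent triangles have opposite orientations, and the up-pointing one has exactly three
neighbors. -/
theorem isLozenge_iff {L : Region} : IsLozenge L ↔
    ∃ h s, L = vert h s ∨ L = rightLozenge h s ∨ L = leftLozenge h s := by
  constructor
  · have key : ∀ {h s h' s'}, (up h s).Adj (down h' s') →
        ∃ k r, ({up h s, down h' s'} : Region) = vert k r ∨
          ({up h s, down h' s'} : Region) = rightLozenge k r ∨
          ({up h s, down h' s'} : Region) = leftLozenge k r := by
      intro h s h' s' hA
      rcases adj_up_down.1 hA with ⟨rfl, rfl⟩ | ⟨rfl, rfl⟩ | ⟨rfl, rfl⟩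
      exacts [⟨_, _, .inl rfl⟩, ⟨_, _, .inr (.inl rfl)⟩, ⟨_, _, .inr (.inr rfl)⟩]
    rintro ⟨s, t, hst, rfl⟩
    rcases up_or_down s with ⟨h, r, rfl⟩ | ⟨h, r, rfl⟩ <;>
      rcases up_or_down t with ⟨h', r', rfl⟩ | ⟨h', r', rfl⟩
    · exact absurd hst not_adj_up_up
    · exact key hst
    · rw [pair_comm]
      exact key (adj_comm.1 hst)
    · exact absurd hst not_adj_down_down
  · rintro ⟨h, s, rfl | rfl | rfl⟩
    exacts [⟨_, _, adj_up_down.2 (by simp), rfl⟩, ⟨_, _, adj_up_down.2 (by simp), rfl⟩,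
      ⟨_, _, adj_up_down.2 (by simp), rfl⟩]

theorem IsLozenge.nonempty {L : Region} (h : IsLozenge L) : L.Nonempty := by
  obtain ⟨s, t, -, rfl⟩ := h
  exact ⟨s, by simp⟩

theorem isLozenge_vert (h s : ℤ) : IsLozenge (vert h s) := isLozenge_iff.2 ⟨h, s, .inl rfl⟩

/-! ### Tilings -/

theorem IsLozengeTiling.subset {G : Region} {T : Finset Region} (hT : IsLozengeTiling G T)
    {L : Region} (hL : L ∈ T) : L ⊆ G := hT.cover ▸ subset_biUnion_of_mem id hL

theorem IsLozengeTiling.eq_of_mem {G : Region} {T : Finset Region} (hT : IsLozengeTiling G T)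
    {L L' : Region} (hL : L ∈ T) (hL' : L' ∈ T) {t : UnitTriangle} (h : t ∈ L) (h' : t ∈ L') :
    L = L' := by
  by_contra hne
  exact disjoint_left.1 (hT.disjoint L hL L' hL' hne) h h'

theorem IsLozengeTiling.exists_mem {G : Region} {T : Finset Region} (hT : IsLozengeTiling G T)
    {t : UnitTriangle} (ht : t ∈ G) : ∃ L ∈ T, t ∈ L := by
  rw [← hT.cover] at ht
  simpa using ht

theorem IsLozengeTiling.union {G G' : Region} {T T' : Finset Region} (hT : IsLozengeTiling G T)
    (hT' : IsLozengeTiling G' T') (h : Disjoint G G') : IsLozengeTiling (G ∪ G') (T ∪ T') where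
  lozenge L hL := (mem_union.1 hL).elim (hT.lozenge L) (hT'.lozenge L)
  disjoint L hL L' hL' hne := by
    rcases mem_union.1 hL with hL | hL <;> rcases mem_union.1 hL' with hL' | hL'
    · exact hT.disjoint L hL L' hL' hne
    · exact h.mono (hT.subset hL) (hT'.subset hL')
    · exact (h.mono (hT.subset hL') (hT'.subset hL)).symm
    · exact hT'.disjoint L hL L' hL' hne
  cover := by rw [union_biUnion, hT.cover, hT'.cover]

theorem IsLozengeTiling.restrict {G : Region} {T : Finset Region} (hT : IsLozengeTiling G T)
    {U : Finset Region} (hU : U ⊆ T) : IsLozengeTiling (U.biUnion id) U where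
  lozenge L hL := hT.lozenge L (hU hL)
  disjoint L hL L' hL' := hT.disjoint L (hU hL) L' (hU hL')
  cover := rfl

theorem isLozengeTiling_vert (h : ℤ) (Z : Finset ℤ) :
    IsLozengeTiling (Z.image (up h) ∪ Z.image (down h)) (Z.image (vert h)) where
  lozenge L hL := by
    obtain ⟨s, -, rfl⟩ := mem_image.1 hL
    exact isLozenge_vert h s
  disjoint L hL L' hL' hne := by
    obtain ⟨s, -, rfl⟩ := mem_image.1 hL
    obtain ⟨s', -, rfl⟩ := mem_image.1 hL'
    have : s ≠ s' := by rintro rfl; exact hne rfl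
    simp [vert, this.symm]
  cover := by
    ext t
    simp only [mem_biUnion, mem_image, id, mem_union, vert]
    constructor
    · rintro ⟨_, ⟨s, hs, rfl⟩, ht⟩
      rcases mem_insert.1 ht with rfl | ht
      · exact .inl ⟨s, hs, rfl⟩
      · exact .inr ⟨s, hs, (mem_singleton.1 ht).symm⟩
    · rintro (⟨s, hs, rfl⟩ | ⟨s, hs, rfl⟩)
      exacts [⟨_, ⟨s, hs, rfl⟩, by simp⟩, ⟨_, ⟨s, hs, rfl⟩, by simp⟩]

/-! ### Cutting a region along a horizontal line -/

/-- The triangle `t` lies above the line `y = h`. -/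
def IsAbove (h : ℤ) (t : UnitTriangle) : Prop := if t.up then h ≤ t.y else h < t.y

instance (h : ℤ) : DecidablePred (IsAbove h) := fun t => by unfold IsAbove; infer_instance

@[simp] theorem isAbove_up {h y s : ℤ} : IsAbove h (up y s) ↔ h ≤ y := by simp [IsAbove, up]

@[simp] theorem isAbove_down {h y s : ℤ} : IsAbove h (down y s) ↔ h < y := by
  simp [IsAbove, down]

/-- The part of `G` above the line `y = h`. -/
def above (h : ℤ) (G : Region) : Region := G.filter (IsAbove h)

/-- The part of `G` below the line `y = h`. -/
def below (h : ℤ) (G : Region) : Region := G.filter (fun t => ¬IsAbove h t)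

/-- The lozenges of `T` above the line `y = h`. -/
def tilesAbove (h : ℤ) (T : Finset Region) : Finset Region :=
  T.filter (fun L => ∀ t ∈ L, IsAbove h t)

/-- The lozenges of `T` below the line `y = h`. -/
def tilesBelow (h : ℤ) (T : Finset Region) : Finset Region :=
  T.filter (fun L => ∀ t ∈ L, ¬IsAbove h t)

/-- The labels of the segments of the line `y = h` which are diagonals of lozenges of `T`. -/
def crossings (h : ℤ) (T : Finset Region) : Finset ℤ :=
  ((T.biUnion id).image (fun t => t.x + 1)).filter (fun s => vert h s ∈ T)

theorem mem_crossings {h s : ℤ} {T : Finset Region} : s ∈ crossings h T ↔ vert h s ∈ T := by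
  unfold crossings
  rw [mem_filter, and_iff_right_iff_imp]
  intro hs
  exact mem_image.2 ⟨up h s, mem_biUnion.2 ⟨_, hs, by simp [vert]⟩, by simp [up]⟩

/-- The labels of the segments of the line `y = h` both of whose triangles belong to `G`. -/
def crossable (h : ℤ) (G : Region) : Finset ℤ :=
  (G.image (fun t => t.x + 1)).filter (fun s => up h s ∈ G ∧ down h s ∈ G)

theorem mem_crossable {h s : ℤ} {G : Region} :
    s ∈ crossable h G ↔ up h s ∈ G ∧ down h s ∈ G := by
  unfold crossable
  rw [mem_filter, and_iff_right_iff_imp]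
  intro hs
  exact mem_image.2 ⟨up h s, hs.1, by simp [up]⟩

/-- Left and right lozenges stay within one horizontal strip of height one, so only a vertical
lozenge can straddle a horizontal lattice line. -/
theorem IsLozenge.trichotomy {L : Region} (hL : IsLozenge L) (h : ℤ) :
    (∀ t ∈ L, IsAbove h t) ∨ (∀ t ∈ L, ¬IsAbove h t) ∨ ∃ s, L = vert h s := by
  obtain ⟨y, s, rfl | rfl | rfl⟩ := isLozenge_iff.1 hL
  · rcases lt_trichotomy y h with hy | rfl | hy
    · right; left; simp [vert]; omega
    · exact .inr (.inr ⟨s, rfl⟩)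
    · left; simp [vert]; omega
  · rcases lt_or_ge y h with hy | hy
    · right; left; simp [rightLozenge]; omega
    · left; simp [rightLozenge]; omega
  · rcases lt_or_ge y h with hy | hy
    · right; left; simp [leftLozenge]; omega
    · left; simp [leftLozenge]; omega

theorem not_above_vert {h s : ℤ} : ¬∀ t ∈ vert h s, IsAbove h t := by simp [vert]

theorem not_below_vert {h s : ℤ} : ¬∀ t ∈ vert h s, ¬IsAbove h t := by simp [vert]

theorem IsLozengeTiling.crossings_subset {G : Region} {T : Finset Region}
    (hT : IsLozengeTiling G T) (h : ℤ) : crossings h T ⊆ crossable h G := by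
  intro s hs
  have := hT.subset (mem_crossings.1 hs)
  exact mem_crossable.2 ⟨this (by simp [vert]), this (by simp [vert])⟩

theorem IsLozengeTiling.restrict_above {G : Region} {T : Finset Region} (hT : IsLozengeTiling G T)
    (h : ℤ) : IsLozengeTiling (above h G \ (crossings h T).image (up h)) (tilesAbove h T) := by
  suffices e : above h G \ (crossings h T).image (up h) = (tilesAbove h T).biUnion id by
    rw [e]
    exact hT.restrict (filter_subset _ T)
  ext t
  simp only [above, tilesAbove, mem_sdiff, mem_filter, mem_image, not_exists, not_and,
    mem_biUnion, id]
  constructor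
  · rintro ⟨⟨htG, hta⟩, htc⟩
    obtain ⟨L, hL, htL⟩ := hT.exists_mem htG
    refine ⟨L, ⟨hL, ?_⟩, htL⟩
    rcases (hT.lozenge L hL).trichotomy h with h1 | h1 | ⟨s, rfl⟩
    · exact h1
    · exact absurd hta (h1 t htL)
    · simp only [vert, mem_insert, mem_singleton] at htL
      rcases htL with rfl | rfl
      · exact absurd rfl (htc s (mem_crossings.2 hL))
      · simp at hta
  · rintro ⟨L, ⟨hL, ha⟩, htL⟩
    refine ⟨⟨hT.subset hL htL, ha t htL⟩, ?_⟩
    rintro s hs rfl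
    have := hT.eq_of_mem hL (mem_crossings.1 hs) htL (by simp [vert])
    subst this
    exact not_above_vert ha

theorem IsLozengeTiling.restrict_below {G : Region} {T : Finset Region} (hT : IsLozengeTiling G T)
    (h : ℤ) : IsLozengeTiling (below h G \ (crossings h T).image (down h)) (tilesBelow h T) := by
  suffices e : below h G \ (crossings h T).image (down h) = (tilesBelow h T).biUnion id by
    rw [e]
    exact hT.restrict (filter_subset _ T)
  ext t
  simp only [below, tilesBelow, mem_sdiff, mem_filter, mem_image, not_exists, not_and,
    mem_biUnion, id]
  constructor
  · rintro ⟨⟨htG, hta⟩, htc⟩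
    obtain ⟨L, hL, htL⟩ := hT.exists_mem htG
    refine ⟨L, ⟨hL, ?_⟩, htL⟩
    rcases (hT.lozenge L hL).trichotomy h with h1 | h1 | ⟨s, rfl⟩
    · exact absurd (h1 t htL) hta
    · exact h1
    · simp only [vert, mem_insert, mem_singleton] at htL
      rcases htL with rfl | rfl
      · simp at hta
      · exact absurd rfl (htc s (mem_crossings.2 hL))
  · rintro ⟨L, ⟨hL, ha⟩, htL⟩
    refine ⟨⟨hT.subset hL htL, ha t htL⟩, ?_⟩
    rintro s hs rfl
    have := hT.eq_of_mem hL (mem_crossings.1 hs) htL (by simp [vert])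
    subst this
    exact not_below_vert ha

/-- The tiling assembled from the lozenges above, below, and on the line `y = h`. -/
def glue (h : ℤ) (Z : Finset ℤ) (T₁ T₂ : Finset Region) : Finset Region :=
  T₁ ∪ T₂ ∪ Z.image (vert h)

theorem IsLozengeTiling.glue_eq {G : Region} {T : Finset Region} (hT : IsLozengeTiling G T)
    (h : ℤ) :
    glue h (crossings h T) (tilesAbove h T)
      (tilesBelow h T) = T := by
  ext L
  simp only [glue, mem_union, tilesAbove, tilesBelow,
    mem_filter, mem_image, mem_crossings]
  constructor
  · rintro ((h1 | h1) | ⟨s, hs, rfl⟩)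
    exacts [h1.1, h1.1, hs]
  · intro hL
    rcases (hT.lozenge L hL).trichotomy h with h1 | h1 | ⟨s, rfl⟩
    exacts [.inl (.inl ⟨hL, h1⟩), .inl (.inr ⟨hL, h1⟩), .inr ⟨s, hL, rfl⟩]

section glue

variable {h : ℤ} {G : Region} {Z : Finset ℤ} {T₁ T₂ : Finset Region}

theorem isLozengeTiling_glue (hZ : Z ⊆ crossable h G)
    (h₁ : IsLozengeTiling (above h G \ Z.image (up h)) T₁)
    (h₂ : IsLozengeTiling (below h G \ Z.image (down h)) T₂) :
    IsLozengeTiling G (glue h Z T₁ T₂) := by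
  have hd : Disjoint (above h G) (below h G) := disjoint_filter_filter_not _ _ _
  have e : G = above h G \ Z.image (up h) ∪ below h G \ Z.image (down h) ∪
      (Z.image (up h) ∪ Z.image (down h)) := by
    ext t
    simp only [mem_union, mem_sdiff, mem_image, above, below, mem_filter]
    constructor
    · intro ht
      by_cases h3 : ∃ s ∈ Z, up h s = t
      · exact .inr (.inl h3)
      by_cases h4 : ∃ s ∈ Z, down h s = t
      · exact .inr (.inr h4)
      by_cases h5 : IsAbove h t
      · exact .inl (.inl ⟨⟨ht, h5⟩, h3⟩)
      · exact .inl (.inr ⟨⟨ht, h5⟩, h4⟩)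
    · rintro ((h3 | h3) | ⟨s, hs, rfl⟩ | ⟨s, hs, rfl⟩)
      exacts [h3.1.1, h3.1.1, (mem_crossable.1 (hZ hs)).1, (mem_crossable.1 (hZ hs)).2]
  rw [e]
  refine (h₁.union h₂ (hd.mono sdiff_subset sdiff_subset)).union (isLozengeTiling_vert h Z) ?_
  rw [disjoint_left]
  simp only [mem_union, mem_sdiff, mem_image, above, below, mem_filter]
  rintro t (⟨⟨-, h3⟩, h4⟩ | ⟨⟨-, h3⟩, h4⟩) (h5 | h5)
  · exact h4 h5
  · obtain ⟨s, -, rfl⟩ := h5; simp at h3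
  · obtain ⟨s, -, rfl⟩ := h5; simp at h3
  · exact h4 h5

theorem above_of_isLozengeTiling (h₁ : IsLozengeTiling (above h G \ Z.image (up h)) T₁)
    {L : Region} (hL : L ∈ T₁) : ∀ t ∈ L, IsAbove h t := fun _ ht =>
  (mem_filter.1 (mem_sdiff.1 (h₁.subset hL ht)).1).2

theorem below_of_isLozengeTiling (h₂ : IsLozengeTiling (below h G \ Z.image (down h)) T₂)
    {L : Region} (hL : L ∈ T₂) : ∀ t ∈ L, ¬IsAbove h t := fun _ ht =>
  (mem_filter.1 (mem_sdiff.1 (h₂.subset hL ht)).1).2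

theorem tilesAbove_glue (h₁ : IsLozengeTiling (above h G \ Z.image (up h)) T₁)
    (h₂ : IsLozengeTiling (below h G \ Z.image (down h)) T₂) :
    tilesAbove h (glue h Z T₁ T₂) = T₁ := by
  ext L
  simp only [tilesAbove, glue, mem_filter, mem_union, mem_image]
  constructor
  · rintro ⟨(h3 | h3) | ⟨s, hs, rfl⟩, ha⟩
    · exact h3
    · obtain ⟨t, ht⟩ := (h₂.lozenge L h3).nonempty
      exact absurd (ha t ht) (below_of_isLozengeTiling h₂ h3 t ht)
    · exact absurd ha not_above_vert
  · exact fun hL => ⟨.inl (.inl hL), above_of_isLozengeTiling h₁ hL⟩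

theorem tilesBelow_glue (h₁ : IsLozengeTiling (above h G \ Z.image (up h)) T₁)
    (h₂ : IsLozengeTiling (below h G \ Z.image (down h)) T₂) :
    tilesBelow h (glue h Z T₁ T₂) = T₂ := by
  ext L
  simp only [tilesBelow, glue, mem_filter, mem_union, mem_image]
  constructor
  · rintro ⟨(h3 | h3) | ⟨s, hs, rfl⟩, ha⟩
    · obtain ⟨t, ht⟩ := (h₁.lozenge L h3).nonempty
      exact absurd (above_of_isLozengeTiling h₁ h3 t ht) (ha t ht)
    · exact h3
    · exact absurd ha not_below_vert
  · exact fun hL => ⟨.inl (.inr hL), below_of_isLozengeTiling h₂ hL⟩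

theorem vert_injective (h : ℤ) : Function.Injective (vert h) := by
  intro s s' e
  have : up h s ∈ vert h s' := e ▸ by simp [vert]
  simpa [vert] using this

theorem crossings_glue (h₁ : IsLozengeTiling (above h G \ Z.image (up h)) T₁)
    (h₂ : IsLozengeTiling (below h G \ Z.image (down h)) T₂) :
    crossings h (glue h Z T₁ T₂) = Z := by
  ext s
  simp only [mem_crossings, glue, mem_union, mem_image]
  constructor
  · rintro ((h3 | h3) | ⟨s', hs, e⟩)
    · exact absurd (above_of_isLozengeTiling h₁ h3) not_above_vert
    · exact absurd (below_of_isLozengeTiling h₂ h3) not_below_vert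
    · exact vert_injective h e ▸ hs
  · exact fun hs => .inr ⟨s, hs, rfl⟩

end glue

/-- Sort the tilings by their crossings Z of the line. For fixed Z, cutting and `glue` are inverse
bijections between tilings of G and pairs of tilings of the two parts, each with its half of the
vertical lozenges removed. -/
theorem tilingCount_eq_sum (h : ℤ) (G : Region) :
    tilingCount G = ∑ Z ∈ (crossable h G).powerset,
      tilingCount (above h G \ Z.image (up h)) * tilingCount (below h G \ Z.image (down h)) := by
  unfold tilingCount
  rw [card_eq_sum_card_fiberwise (f := crossings h) (t := (crossable h G).powerset)
    (fun T hT => mem_coe.2 (mem_powerset.2 ((mem_lozengeTilings.1 hT).crossings_subset h)))]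
  refine sum_congr rfl fun Z hZ => ?_
  rw [mem_powerset] at hZ
  rw [← card_product]
  refine card_nbij' (fun T => (tilesAbove h T, tilesBelow h T)) (fun p => glue h Z p.1 p.2)
    ?_ ?_ ?_ ?_
  · intro T hT'
    obtain ⟨hT, rfl⟩ := mem_filter.1 (mem_coe.1 hT')
    rw [mem_lozengeTilings] at hT
    exact mem_coe.2 <| mem_product.2 ⟨mem_lozengeTilings.2 (hT.restrict_above h),
      mem_lozengeTilings.2 (hT.restrict_below h)⟩
  · intro p hp
    obtain ⟨h1, h2⟩ := mem_product.1 (mem_coe.1 hp)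
    rw [mem_lozengeTilings] at h1 h2
    exact mem_coe.2 <| mem_filter.2 ⟨mem_lozengeTilings.2 (isLozengeTiling_glue hZ h1 h2),
      crossings_glue h1 h2⟩
  · intro T hT'
    obtain ⟨hT, rfl⟩ := mem_filter.1 (mem_coe.1 hT')
    exact (mem_lozengeTilings.1 hT).glue_eq h
  · intro p hp
    obtain ⟨h1, h2⟩ := mem_product.1 (mem_coe.1 hp)
    rw [mem_lozengeTilings] at h1 h2
    exact Prod.ext (tilesAbove_glue h1 h2) (tilesBelow_glue h1 h2)

/-! ### Sums of Vandermonde determinants over interlacing sequences -/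

/-- Falling factorials play the role of powers in discrete calculus: the sum telescopes. -/
theorem sum_Ico_descPochhammer (j : ℕ) {u v : ℤ} (h : u ≤ v) :
    ∑ t ∈ Ico u v, ((j : ℤ) + 1) * (descPochhammer ℤ j).eval t =
      (descPochhammer ℤ (j + 1)).eval v - (descPochhammer ℤ (j + 1)).eval u := by
  induction v, h using Int.leInduction with
  | base => simp
  | succ v hv ih =>
    have e : Ico u (v + 1) = insert v (Ico u v) := by ext; simp; omega
    rw [e, sum_insert (by simp), ih]
    have h1 : (descPochhammer ℤ (j + 1)).eval (v + 1) =
        (v + 1) * (descPochhammer ℤ j).eval v := by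
      simp [descPochhammer_succ_left]
    rw [h1, descPochhammer_succ_eval]
    ring

/-- The falling factorials are monic of degree j, so passing to them from the powers is a
unitriangular column operation. -/
theorem det_vandermonde_eq_det_descPochhammer {n : ℕ} (v : Fin n → ℤ) :
    (Matrix.vandermonde v).det =
      (Matrix.of fun i j : Fin n => (descPochhammer ℤ j).eval (v i)).det :=
  Matrix.det_eval_matrixOfPolynomials_eq_det_vandermonde v (fun j => descPochhammer ℤ j)
    (fun j => descPochhammer_natDegree ℤ j) (fun j => monic_descPochhammer ℤ j)

/-- In the falling factorial basis the determinant is multilinear in its rows, and each row depends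
on one variable only. The sum can therefore be carried out row by row, each entry telescoping to a
difference of consecutive rows of the larger matrix. -/
theorem sum_piFinset_det_vandermonde {m : ℕ} {s : Fin (m + 1) → ℤ} (hs : Monotone s) :
    (m.factorial : ℤ) * ∑ t ∈ Fintype.piFinset (fun i : Fin m => Ico (s i.castSucc) (s i.succ)),
      (Matrix.vandermonde t).det = (Matrix.vandermonde s).det := by
  simp_rw [det_vandermonde_eq_det_descPochhammer]
  have h1 := (Matrix.detRowAlternating (n := Fin m) (R := ℤ)).toMultilinearMap.map_sum_finset
    (fun _ (x : ℤ) (j : Fin m) => (descPochhammer ℤ j).eval x)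
    (fun i : Fin m => Ico (s i.castSucc) (s i.succ))
  have h2 : (m.factorial : ℤ) = ∏ j : Fin m, ((j : ℤ) + 1) := by
    rw [Fin.prod_univ_eq_prod_range (fun j : ℕ => (j : ℤ) + 1) m,
      ← prod_range_add_one_eq_factorial]
    push_cast
    rfl
  have h3 : ∑ t ∈ Fintype.piFinset (fun i : Fin m => Ico (s i.castSucc) (s i.succ)),
      (Matrix.of fun i j : Fin m => (descPochhammer ℤ j).eval (t i)).det =
      (Matrix.of fun i j : Fin m => ∑ x ∈ Ico (s i.castSucc) (s i.succ),
        (descPochhammer ℤ j).eval x).det := by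
    refine h1.symm.trans ?_
    refine congrArg Matrix.det ?_
    ext i j
    simp [Finset.sum_apply]
  -- The factor j + 1 of m! is absorbed into column j, where the telescoping identity requires it.
  rw [h3, h2, ← Matrix.det_mul_row]
  -- Subtract from each row the preceding one. Column 0 consists of ones, so it becomes (1, 0, …,
  -- 0), and expanding along it leaves an m × m determinant.
  have h4 : (Matrix.of fun i j : Fin (m + 1) => (descPochhammer ℤ j).eval (s i)).det =
      (Matrix.of fun i j : Fin (m + 1) => (Fin.cases ((descPochhammer ℤ j).eval (s 0))
        (fun i : Fin m => (descPochhammer ℤ j).eval (s i.succ) -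
          (descPochhammer ℤ j).eval (s i.castSucc)) i : ℤ)).det :=
    Matrix.det_eq_of_forall_row_eq_smul_add_pred (fun _ => 1) (fun j => by simp)
      (fun i j => by simp)
  rw [h4, Matrix.det_succ_column_zero, Fin.sum_univ_succ]
  simp only [Matrix.of_apply, Fin.cases_zero, Fin.cases_succ, Fin.val_zero, pow_zero, one_mul,
    descPochhammer_zero, Polynomial.eval_one, sub_self, mul_zero, zero_mul, sum_const_zero,
    add_zero]
  refine congrArg Matrix.det ?_
  ext i j
  simp [← mul_sum, ← sum_Ico_descPochhammer j (hs i.castSucc_le_succ)]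

theorem delta_eq_prod (S : Finset ℤ) :
    delta S = ∏ p ∈ S, ∏ q ∈ S.filter (p < ·), (q - p) := by
  simp_rw [delta, prod_filter, prod_product]

theorem delta_pos (S : Finset ℤ) : 0 < delta S :=
  prod_pos fun _ hp => sub_pos.2 (mem_filter.1 hp).2

theorem delta_image {n : ℕ} {s : Fin n → ℤ} (hs : StrictMono s) :
    delta (univ.image s) = (Matrix.vandermonde s).det := by
  rw [delta_eq_prod, Matrix.det_vandermonde, prod_image hs.injective.injOn]
  refine prod_congr rfl fun i _ => ?_
  rw [filter_image, prod_image hs.injective.injOn]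
  refine prod_congr ?_ fun _ _ => rfl
  ext j
  simp [hs.lt_iff_lt]

/-- The number of elements of `S` smaller than `x`, minus the same number for `Z`. -/
def excess (S Z : Finset ℤ) (x : ℤ) : ℤ :=
  ((S.filter (· < x)).card : ℤ) - (Z.filter (· < x)).card

/-- The elements `s₀ < ⋯ < sₘ` of `S` and `z₁ < ⋯ < zₘ` of `Z` satisfy
`s₀ ≤ z₁ < s₁ ≤ z₂ < ⋯ < sₘ`. -/
def Interlaces (S Z : Finset ℤ) : Prop :=
  S.card = Z.card + 1 ∧ ∀ x, excess S Z x = 0 ∨ (excess S Z x = 1 ∧ x ∉ S)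

/-- This translates between inequalities for a sorted sequence and the counting functions in
`excess`. -/
theorem lt_iff_lt_card {n : ℕ} {s : Fin n → ℤ} (hs : StrictMono s) (x : ℤ) (i : Fin n) :
    s i < x ↔ (i : ℕ) < ((univ.image s).filter (· < x)).card := by
  rw [filter_image, card_image_of_injective _ hs.injective]
  constructor
  · intro h
    have : Iic i ⊆ univ.filter (fun j => s j < x) := fun j hj =>
      mem_filter.2 ⟨mem_univ _, (hs.monotone (mem_Iic.1 hj)).trans_lt h⟩
    have := card_le_card this
    rw [Fin.card_Iic] at this
    omega
  · intro h
    by_contra hx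
    have : univ.filter (fun j => s j < x) ⊆ Iio i := fun j hj => by
      rw [mem_Iio, ← hs.lt_iff_lt]
      exact (mem_filter.1 hj).2.trans_le (not_lt.1 hx)
    have := card_le_card this
    rw [Fin.card_Iio] at this
    omega

theorem strictMono_of_mem_piFinset {m : ℕ} {s : Fin (m + 1) → ℤ} (hs : StrictMono s)
    {t : Fin m → ℤ}
    (ht : t ∈ Fintype.piFinset (fun i : Fin m => Ico (s i.castSucc) (s i.succ))) :
    StrictMono t := by
  intro i j hij
  have hi := mem_Ico.1 (Fintype.mem_piFinset.1 ht i)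
  have hj := mem_Ico.1 (Fintype.mem_piFinset.1 ht j)
  exact hi.2.trans_le ((hs.monotone (Fin.succ_le_castSucc_iff.2 hij)).trans hj.1)

theorem card_filter_image_le {n : ℕ} (s : Fin n → ℤ) (x : ℤ) :
    ((univ.image s).filter (· < x)).card ≤ n :=
  (card_le_card (filter_subset _ _)).trans (card_image_le.trans (by simp))

theorem interlaces_of_mem_piFinset {m : ℕ} {s : Fin (m + 1) → ℤ} (hs : StrictMono s)
    {t : Fin m → ℤ}
    (ht : t ∈ Fintype.piFinset (fun i : Fin m => Ico (s i.castSucc) (s i.succ))) :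
    Interlaces (univ.image s) (univ.image t) := by
  have htm := strictMono_of_mem_piFinset hs ht
  refine ⟨by simp [card_image_of_injective, hs.injective, htm.injective], fun x => ?_⟩
  have hst : ∀ i : ℕ, ∀ hi : i < m, s ⟨i, by omega⟩ ≤ t ⟨i, hi⟩ ∧
      t ⟨i, hi⟩ < s ⟨i + 1, by omega⟩ := fun i hi =>
    mem_Ico.1 (Fintype.mem_piFinset.1 ht ⟨i, hi⟩)
  have hp := lt_iff_lt_card hs x
  have hq := lt_iff_lt_card htm x
  have hpm := card_filter_image_le s x
  have hqm := card_filter_image_le t x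
  unfold excess
  generalize ((univ.image s).filter (· < x)).card = p at *
  generalize ((univ.image t).filter (· < x)).card = q at *
  have h1 : q ≤ p := by
    by_contra! h
    have := (hp ⟨p, by omega⟩).1 ((hst p (by omega)).1.trans_lt ((hq ⟨p, by omega⟩).2 h))
    simp at this
  have h2 : p ≤ q + 1 := by
    by_contra! h
    have := (hq ⟨q, by omega⟩).1 ((hst q (by omega)).2.trans ((hp ⟨q + 1, by omega⟩).2 h))
    simp at this
  rcases h1.eq_or_lt with rfl | h1
  · simp
  · obtain rfl : p = q + 1 := by omega
    -- If x were some s_j, the count p = q + 1 of smaller elements would force j = q + 1. Then t_q <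
    -- s_{q+1} = x, although only q terms of t lie below x.
    refine .inr ⟨by push_cast; ring, fun hx => ?_⟩
    obtain ⟨⟨j, hj⟩, -, rfl⟩ := mem_image.1 hx
    have h3 := hp ⟨j, hj⟩
    simp only [lt_self_iff_false, false_iff, not_lt] at h3
    have h4 : j ≤ q + 1 := by
      rcases j with - | j
      · omega
      · have := (hp ⟨j, by omega⟩).1 (hs (by simp [Fin.lt_def]))
        simp only at this
        omega
    obtain rfl : j = q + 1 := by omega
    have := (hq ⟨q, by omega⟩).1 (hst q (by omega)).2
    simp at this

theorem exists_mem_piFinset_of_interlaces {m : ℕ} {s : Fin (m + 1) → ℤ} (hs : StrictMono s)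
    {Z : Finset ℤ} (hZ : Interlaces (univ.image s) Z) :
    ∃ t ∈ Fintype.piFinset (fun i : Fin m => Ico (s i.castSucc) (s i.succ)),
      Z = univ.image t := by
  obtain ⟨hcard, hx⟩ := hZ
  rw [card_image_of_injective _ hs.injective, card_univ, Fintype.card_fin] at hcard
  have hm : Z.card = m := by omega
  obtain ⟨t, htm, rfl⟩ : ∃ t : Fin m → ℤ, StrictMono t ∧ Z = univ.image t :=
    ⟨Z.orderEmbOfFin hm, (Z.orderEmbOfFin hm).strictMono, by simp⟩
  refine ⟨t, Fintype.mem_piFinset.2 fun i => ?_, rfl⟩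
  have hx0 := hx (t i)
  have hx1 := hx (t i + 1)
  have hp0 := lt_iff_lt_card hs (t i)
  have hq0 := lt_iff_lt_card htm (t i)
  have hp1 := lt_iff_lt_card hs (t i + 1)
  have hq1 := lt_iff_lt_card htm (t i + 1)
  unfold excess at hx0 hx1
  generalize ((univ.image s).filter (· < t i)).card = p0 at *
  generalize ((univ.image t).filter (· < t i)).card = q0 at *
  generalize ((univ.image s).filter (· < t i + 1)).card = p1 at *
  generalize ((univ.image t).filter (· < t i + 1)).card = q1 at *
  have e0 : (i : ℕ) ≤ q0 := by
    by_contra! h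
    have := (hq0 ⟨q0, by omega⟩).1 (htm (Fin.lt_def.2 h))
    simp at this
  have e0' : q0 ≤ i := not_lt.1 fun h => lt_irrefl _ ((hq0 i).2 h)
  have e1 : (i : ℕ) < q1 := (hq1 i).1 (by omega)
  have hsm : s i.castSucc < s i.succ := hs i.castSucc_lt_succ
  have a0 := hp0 i.castSucc
  have a1 := hp0 i.succ
  have a2 := hp1 i.castSucc
  simp only [Fin.val_castSucc, Fin.val_succ] at a0 a1 a2
  rw [mem_Ico]
  -- The bound s_i ≤ t_i comes from the excess at t_i + 1. For t_i < s_{i+1}: excess 0 at t_i gives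
  -- t_i ≤ s_i < s_{i+1}, while excess 1 gives only t_i ≤ s_{i+1}, made strict by the clause x ∉ S.
  rcases hx0 with h0 | ⟨h0, hn⟩
  · omega
  · have : s i.succ ≠ t i := fun e => hn (e ▸ mem_image_of_mem _ (mem_univ _))
    omega

theorem exists_strictMono_image_eq {S : Finset ℤ} {n : ℕ} (h : S.card = n) :
    ∃ s : Fin n → ℤ, StrictMono s ∧ univ.image s = S :=
  ⟨S.orderEmbOfFin h, (S.orderEmbOfFin h).strictMono, by simp⟩

theorem Interlaces.exists_le_lt {S Z : Finset ℤ} (h : Interlaces S Z) {z : ℤ} (hz : z ∈ Z) :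
    (∃ s ∈ S, s ≤ z) ∧ ∃ s ∈ S, z < s := by
  obtain ⟨s, hs, rfl⟩ := exists_strictMono_image_eq h.1
  obtain ⟨t, ht, e⟩ := exists_mem_piFinset_of_interlaces hs h
  rw [e] at hz
  obtain ⟨i, -, rfl⟩ := mem_image.1 hz
  have := mem_Ico.1 (Fintype.mem_piFinset.1 ht i)
  exact ⟨⟨_, mem_image_of_mem _ (mem_univ _), this.1⟩,
    ⟨_, mem_image_of_mem _ (mem_univ _), this.2⟩⟩

open Classical in
-- The family F is arbitrary as long as it contains all interlacing sets, so that the sum over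
-- crossing sets fits.
theorem sum_delta_interlaces {S : Finset ℤ} {m : ℕ} (hS : S.card = m + 1)
    {F : Finset (Finset ℤ)} (hF : ∀ Z, Interlaces S Z → Z ∈ F) :
    (m.factorial : ℤ) * ∑ Z ∈ F, (if Interlaces S Z then delta Z else 0) = delta S := by
  obtain ⟨s, hs, rfl⟩ := exists_strictMono_image_eq hS
  rw [delta_image hs, ← sum_piFinset_det_vandermonde hs.monotone, ← sum_filter]
  congr 1
  symm
  refine sum_bij (fun t _ => univ.image t) ?_ ?_ ?_ ?_
  · intro t ht
    have := interlaces_of_mem_piFinset hs ht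
    exact mem_filter.2 ⟨hF _ this, this⟩
  · intro t ht t' ht' e
    have := strictMono_of_mem_piFinset hs ht
    have h' := strictMono_of_mem_piFinset hs ht'
    refine (this.range_inj h').1 ?_
    simpa using congrArg (fun A : Finset ℤ => (A : Set ℤ)) e
  · intro Z hZ
    obtain ⟨t, ht, rfl⟩ := exists_mem_piFinset_of_interlaces hs (mem_filter.1 hZ).2
    exact ⟨t, ht, rfl⟩
  · intro t ht
    exact (delta_image (strictMono_of_mem_piFinset hs ht)).symm

/-! ### Tilings of a strip of height one -/

theorem leftLozenge_ne_rightLozenge {h s h' s' : ℤ} : leftLozenge h s ≠ rightLozenge h' s' := by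
  intro e
  have h1 : up h s ∈ rightLozenge h' s' := e ▸ by simp [leftLozenge]
  have h2 : down (h + 1) (s - 1) ∈ rightLozenge h' s' := e ▸ by simp [leftLozenge]
  simp [rightLozenge] at h1 h2
  omega

theorem leftLozenge_injective (h : ℤ) : Function.Injective (leftLozenge h) := by
  intro s s' e
  have : up h s ∈ leftLozenge h s' := e ▸ by simp [leftLozenge]
  simpa [leftLozenge] using this

/-- The strip between the lines `y = h` and `y = h + 1` with `n` up-pointing and `n - 1`
down-pointing triangles, with the up-pointing triangles at the labels in `S` and the down-pointing
triangles at the labels in `Z` removed. -/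
noncomputable def dentedStrip (h n : ℤ) (S Z : Finset ℤ) : Region :=
  (Icc 1 n \ S).image (up h) ∪ (Icc 1 (n - 1) \ Z).image (down (h + 1))

section strip

variable {h n : ℤ} {S Z : Finset ℤ}

@[simp] theorem up_mem_dentedStrip {y s : ℤ} :
    up y s ∈ dentedStrip h n S Z ↔ y = h ∧ (1 ≤ s ∧ s ≤ n) ∧ s ∉ S := by
  simp [dentedStrip]
  grind

@[simp] theorem down_mem_dentedStrip {y s : ℤ} :
    down y s ∈ dentedStrip h n S Z ↔ y = h + 1 ∧ (1 ≤ s ∧ s ≤ n - 1) ∧ s ∉ Z := by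
  simp [dentedStrip]
  grind

theorem lozenge_of_dentedStrip {T : Finset Region}
    (hT : IsLozengeTiling (dentedStrip h n S Z) T) {L : Region} (hL : L ∈ T) :
    ∃ s ∈ Icc 1 n \ S, L = rightLozenge h s ∨ L = leftLozenge h s := by
  have hsub := hT.subset hL
  obtain ⟨y, s, rfl | rfl | rfl⟩ := isLozenge_iff.1 (hT.lozenge L hL)
  · have h1 : up y s ∈ dentedStrip h n S Z := hsub (by simp [vert])
    have h2 : down y s ∈ dentedStrip h n S Z := hsub (by simp [vert])
    simp at h1 h2
    omega
  · have h1 : up y s ∈ dentedStrip h n S Z := hsub (by simp [rightLozenge])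
    obtain ⟨rfl, h1⟩ := up_mem_dentedStrip.1 h1
    exact ⟨s, by simpa using h1, .inl rfl⟩
  · have h1 : up y s ∈ dentedStrip h n S Z := hsub (by simp [leftLozenge])
    obtain ⟨rfl, h1⟩ := up_mem_dentedStrip.1 h1
    exact ⟨s, by simpa using h1, .inr rfl⟩

/-- The contribution of a triangle to the difference of the numbers of up- and down-pointing
triangles with labels less than `x`. -/
def sideWeight (x : ℤ) (t : UnitTriangle) : ℤ :=
  if t.x + 1 < x then if t.up then 1 else -1 else 0

theorem sideWeight_up (x y s : ℤ) : sideWeight x (up y s) = if s < x then 1 else 0 := by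
  simp [sideWeight, up]

theorem sideWeight_down (x y s : ℤ) : sideWeight x (down y s) = -(if s < x then 1 else 0) := by
  by_cases hs : s < x <;> simp [sideWeight, down, hs]

theorem card_filter_sdiff {A B : Finset ℤ} (hB : B ⊆ A) (x : ℤ) :
    (((A \ B).filter (· < x)).card : ℤ) = (A.filter (· < x)).card - (B.filter (· < x)).card := by
  have e : (A \ B).filter (· < x) = A.filter (· < x) \ B.filter (· < x) := by
    ext; simp only [mem_filter, mem_sdiff]; tauto
  rw [e, cast_card_sdiff (filter_subset_filter _ hB)]

theorem card_filter_Icc (m x : ℤ) :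
    (((Icc 1 m).filter (· < x)).card : ℤ) = max 0 (min m (x - 1)) := by
  have e : (Icc 1 m).filter (· < x) = Icc 1 (min m (x - 1)) := by
    ext; simp only [mem_filter, mem_Icc]; omega
  rw [e, Int.card_Icc]
  omega

theorem sum_sideWeight_dentedStrip (hS : S ⊆ Icc 1 n) (hZ : Z ⊆ Icc 1 (n - 1)) (x : ℤ) :
    ∑ t ∈ dentedStrip h n S Z, sideWeight x t =
      max 0 (min n (x - 1)) - max 0 (min (n - 1) (x - 1)) - excess S Z x := by
  have hd : Disjoint ((Icc 1 n \ S).image (up h)) ((Icc 1 (n - 1) \ Z).image (down (h + 1))) := by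
    rw [disjoint_left]
    intro t h1 h2
    obtain ⟨s, -, rfl⟩ := mem_image.1 h1
    obtain ⟨s', -, e⟩ := mem_image.1 h2
    exact down_ne_up e
  rw [dentedStrip, sum_union hd, sum_image (up_injective h).injOn,
    sum_image (down_injective (h + 1)).injOn]
  simp_rw [sideWeight_up, sideWeight_down, sum_neg_distrib, ← sum_filter, sum_const,
    nsmul_eq_mul, mul_one]
  rw [card_filter_sdiff hS, card_filter_sdiff hZ, card_filter_Icc, card_filter_Icc, excess]
  ring

/-- The two triangles of a right lozenge have the same label and cancel. Those of a left lozenge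
have labels s and s − 1 and cancel unless x = s. So the weight of the strip detects one particular
left lozenge. -/
theorem sum_sideWeight_tiling {T : Finset Region}
    (hT : IsLozengeTiling (dentedStrip h n S Z) T) (x : ℤ) :
    ∑ t ∈ dentedStrip h n S Z, sideWeight x t = -(if leftLozenge h x ∈ T then 1 else 0) := by
  rw [← hT.cover, sum_biUnion (t := id) fun L hL L' hL' hne => hT.disjoint L hL L' hL' hne]
  have e : ∀ L ∈ T, ∑ t ∈ id L, sideWeight x t = if L = leftLozenge h x then -1 else 0 := by
    intro L hL
    obtain ⟨s, -, rfl | rfl⟩ := lozenge_of_dentedStrip hT hL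
    · rw [if_neg leftLozenge_ne_rightLozenge.symm, id, rightLozenge, sum_pair up_ne_down,
        sideWeight_up, sideWeight_down, add_neg_cancel]
    · simp only [(leftLozenge_injective h).eq_iff]
      rw [id, leftLozenge, sum_pair up_ne_down, sideWeight_up, sideWeight_down]
      split_ifs <;> omega
  rw [sum_congr rfl e, sum_ite_eq']
  split_ifs <;> simp

theorem filter_lt_eq_self {A : Finset ℤ} {m x : ℤ} (hA : A ⊆ Icc 1 m) (hx : m < x) :
    A.filter (· < x) = A :=
  filter_true_of_mem fun _ hy => (mem_Icc.1 (hA hy)).2.trans_lt hx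

theorem excess_eq_of_tiling (hS : S ⊆ Icc 1 n) (hZ : Z ⊆ Icc 1 (n - 1)) {T : Finset Region}
    (hT : IsLozengeTiling (dentedStrip h n S Z) T) {x : ℤ} (hx : x ≤ n) :
    excess S Z x = if leftLozenge h x ∈ T then 1 else 0 := by
  have := (sum_sideWeight_dentedStrip (h := h) hS hZ x).symm.trans (sum_sideWeight_tiling hT x)
  omega

theorem not_leftLozenge_of_tiling {T : Finset Region}
    (hT : IsLozengeTiling (dentedStrip h n S Z) T) {x : ℤ} (hL : leftLozenge h x ∈ T) :
    x ≤ n ∧ x ∉ S := by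
  have : up h x ∈ dentedStrip h n S Z := hT.subset hL (by simp [leftLozenge])
  rw [up_mem_dentedStrip] at this
  exact ⟨this.2.1.2, this.2.2⟩

theorem interlaces_of_tiling (hn : 1 ≤ n) (hS : S ⊆ Icc 1 n) (hZ : Z ⊆ Icc 1 (n - 1))
    {T : Finset Region} (hT : IsLozengeTiling (dentedStrip h n S Z) T) : Interlaces S Z := by
  have key : ∀ x, n < x → excess S Z x = (S.card : ℤ) - Z.card := fun x hx => by
    rw [excess, filter_lt_eq_self hS hx, filter_lt_eq_self hZ (by omega)]
  have hcard : (S.card : ℤ) - Z.card = 1 := by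
    -- At x = n + 1 all labels are counted and no left lozenge with label n + 1 fits. So the strip
    -- has as many up- as down-pointing triangles, starting from n and n − 1 before removals.
    have h1 := (sum_sideWeight_dentedStrip (h := h) hS hZ (n + 1)).symm.trans
      (sum_sideWeight_tiling hT (n + 1))
    rw [key _ (by omega), if_neg fun hL => by
      have := (not_leftLozenge_of_tiling hT hL).1
      omega] at h1
    omega
  refine ⟨by omega, fun x => ?_⟩
  rcases le_or_gt x n with hx | hx
  · rw [excess_eq_of_tiling hS hZ hT hx]
    split_ifs with hL
    · exact .inr ⟨rfl, (not_leftLozenge_of_tiling hT hL).2⟩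
    · exact .inl rfl
  · refine .inr ⟨by rw [key x hx, hcard], fun hxS => ?_⟩
    have := (mem_Icc.1 (hS hxS)).2
    omega

/-- The only possible lozenge covering `up h x` in a tiling of a dented strip. -/
def stripLozenge (h : ℤ) (S Z : Finset ℤ) (x : ℤ) : Region :=
  if excess S Z x = 1 then leftLozenge h x else rightLozenge h x

/-- Uniqueness: the excess at x, which depends only on S and Z, decides whether the lozenge covering
`up h x` leans left or right. -/
theorem tiling_eq_image (hS : S ⊆ Icc 1 n) (hZ : Z ⊆ Icc 1 (n - 1)) {T : Finset Region}
    (hT : IsLozengeTiling (dentedStrip h n S Z) T) :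
    T = (Icc 1 n \ S).image (stripLozenge h S Z) := by
  have key : ∀ L ∈ T, ∀ x, up h x ∈ L → L = stripLozenge h S Z x := by
    intro L hL x hx
    obtain ⟨s, hs, hLs⟩ := lozenge_of_dentedStrip hT hL
    have hsn : s ≤ n := (mem_Icc.1 (mem_sdiff.1 hs).1).2
    have hc := excess_eq_of_tiling hS hZ hT hsn
    rcases hLs with rfl | rfl
    · obtain rfl : x = s := by simpa [rightLozenge] using hx
      rw [stripLozenge, if_neg]
      rw [hc, if_neg]
      · simp
      · intro h'
        exact leftLozenge_ne_rightLozenge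
          (hT.eq_of_mem h' hL (t := up h x) (by simp [leftLozenge]) hx)
    · obtain rfl : x = s := by simpa [leftLozenge] using hx
      rw [stripLozenge, if_pos]
      rw [hc, if_pos hL]
  ext L
  rw [mem_image]
  constructor
  · intro hL
    obtain ⟨s, hs, hLs⟩ := lozenge_of_dentedStrip hT hL
    refine ⟨s, hs, (key L hL s ?_).symm⟩
    rcases hLs with rfl | rfl <;> simp [leftLozenge, rightLozenge]
  · rintro ⟨x, hx, rfl⟩
    have : up h x ∈ dentedStrip h n S Z := by simpa using hx
    obtain ⟨L, hL, hxL⟩ := hT.exists_mem this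
    rwa [← key L hL x hxL]

theorem card_filter_lt_succ (A : Finset ℤ) (x : ℤ) :
    (A.filter (· < x + 1)).card = (A.filter (· < x)).card + if x ∈ A then 1 else 0 := by
  split_ifs with hx
  · have e : A.filter (· < x + 1) = insert x (A.filter (· < x)) := by
      ext y
      simp only [mem_filter, mem_insert]
      constructor
      · rintro ⟨h1, h2⟩
        rcases eq_or_ne y x with rfl | h3
        · exact .inl rfl
        · exact .inr ⟨h1, by omega⟩
      · rintro (rfl | ⟨h1, h2⟩)
        exacts [⟨hx, by omega⟩, ⟨h1, by omega⟩]
    rw [e, card_insert_of_notMem (by simp)]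
  · congr 1
    ext y
    simp only [mem_filter]
    constructor
    · rintro ⟨h1, h2⟩
      have : y ≠ x := by rintro rfl; exact hx h1
      exact ⟨h1, by omega⟩
    · rintro ⟨h1, h2⟩
      exact ⟨h1, by omega⟩

theorem excess_succ (S Z : Finset ℤ) (x : ℤ) : excess S Z (x + 1) =
    excess S Z x + (if x ∈ S then 1 else 0) - if x ∈ Z then 1 else 0 := by
  unfold excess
  rw [card_filter_lt_succ, card_filter_lt_succ]
  push_cast
  ring

theorem excess_one (hS : S ⊆ Icc 1 n) (hZ : Z ⊆ Icc 1 (n - 1)) : excess S Z 1 = 0 := by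
  have key : ∀ {A : Finset ℤ} {m : ℤ}, A ⊆ Icc 1 m → A.filter (· < 1) = ∅ := fun hA =>
    filter_eq_empty_iff.2 fun x hx => not_lt.2 (mem_Icc.1 (hA hx)).1
  rw [excess, key hS, key hZ]
  simp

theorem excess_last (hS : S ⊆ Icc 1 n) (hZ : Z ⊆ Icc 1 (n - 1)) (hI : Interlaces S Z) :
    excess S Z (n + 1) = 1 := by
  rw [excess, filter_lt_eq_self hS (by omega), filter_lt_eq_self hZ (by omega), hI.1]
  push_cast
  ring

/-- The label of the down-pointing triangle of `stripLozenge h S Z x`. -/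
theorem stripLozenge_eq (hI : Interlaces S Z) (x : ℤ) :
    stripLozenge h S Z x = {up h x, down (h + 1) (x - excess S Z x)} := by
  unfold stripLozenge
  rcases hI.2 x with h0 | ⟨h0, -⟩ <;> simp [h0, leftLozenge, rightLozenge]

theorem isLozengeTiling_dentedStrip (hS : S ⊆ Icc 1 n) (hZ : Z ⊆ Icc 1 (n - 1))
    (hI : Interlaces S Z) :
    IsLozengeTiling (dentedStrip h n S Z) ((Icc 1 n \ S).image (stripLozenge h S Z)) where
  lozenge L hL := by
    obtain ⟨x, -, rfl⟩ := mem_image.1 hL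
    unfold stripLozenge
    split_ifs
    exacts [isLozenge_iff.2 ⟨h, x, .inr (.inr rfl)⟩, isLozenge_iff.2 ⟨h, x, .inr (.inl rfl)⟩]
  disjoint L hL L' hL' hne := by
    obtain ⟨x, hx, rfl⟩ := mem_image.1 hL
    obtain ⟨x', hx', rfl⟩ := mem_image.1 hL'
    have hxx : x ≠ x' := by rintro rfl; exact hne rfl
    have key : ∀ y ∈ Icc 1 n \ S, ∀ y', y < y' → y - excess S Z y ≠ y' - excess S Z y' := by
      intro y hy y' hlt he
      have h1 := hI.2 y
      have h2 := hI.2 y'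
      -- Excesses are 0 or 1, so a collision requires neighboring labels and an excess rising from 0
      -- to 1 at y. A rise needs y ∈ S.
      obtain rfl : y' = y + 1 := by omega
      have h3 := excess_succ S Z y
      rw [if_neg (mem_sdiff.1 hy).2] at h3
      split_ifs at h3 <;> omega
    have hd : x - excess S Z x ≠ x' - excess S Z x' := by
      rcases lt_or_gt_of_ne hxx with hlt | hlt
      · exact key x hx x' hlt
      · exact (key x' hx' x hlt).symm
    rw [stripLozenge_eq hI, stripLozenge_eq hI]
    simp [hxx.symm, hd.symm]
  cover := by
    ext t
    simp only [mem_biUnion, mem_image, id, exists_exists_and_eq_and, stripLozenge_eq hI,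
      mem_insert, mem_singleton]
    rcases up_or_down t with ⟨y, s, rfl⟩ | ⟨y, s, rfl⟩
    · simp only [up_inj, up_ne_down, or_false, up_mem_dentedStrip]
      constructor
      · rintro ⟨x, hx, rfl, rfl⟩
        simpa using hx
      · rintro ⟨rfl, h1⟩
        exact ⟨s, by simpa using h1, rfl, rfl⟩
    · simp only [down_inj, down_ne_up, false_or, down_mem_dentedStrip, mem_sdiff, mem_Icc]
      constructor
      · rintro ⟨x, ⟨hx, hxS⟩, rfl, rfl⟩
        refine ⟨rfl, ?_⟩
        -- The partner must not be a dent. With excess 0, x ∈ Z would make the next excess −1. With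
        -- excess 1, x − 1 ∈ Z would need excess 1 at x − 1 together with x − 1 ∈ S, which
        -- interlacing forbids.
        rcases hI.2 x with h0 | ⟨h0, -⟩
        · have h1 := excess_succ S Z x
          rw [if_neg hxS] at h1
          have h2 := hI.2 (x + 1)
          have hxZ : x ∉ Z := fun hxZ => by
            rw [if_pos hxZ] at h1
            omega
          rw [if_neg hxZ] at h1
          have h3 : x ≠ n := by
            rintro rfl
            have := excess_last hS hZ hI
            omega
          rw [h0, sub_zero]
          exact ⟨by omega, hxZ⟩
        · have h1 := excess_succ S Z (x - 1)
          rw [sub_add_cancel] at h1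
          have h3 : x ≠ 1 := by
            rintro rfl
            have := excess_one hS hZ
            omega
          rw [h0]
          refine ⟨by omega, fun hxZ => ?_⟩
          rw [if_pos hxZ] at h1
          rcases hI.2 (x - 1) with h2 | ⟨h2, h2'⟩
          · split_ifs at h1 <;> omega
          · rw [if_neg h2'] at h1
            omega
      · rintro ⟨rfl, hs, hsZ⟩
        have h1 := excess_succ S Z s
        rw [if_neg hsZ] at h1
        -- Excess 1 at s + 1 means that the left lozenge of s + 1 covers this triangle. Excess 0
        -- forces excess 0 at s and s ∉ S, and the right lozenge of s covers it.
        rcases hI.2 (s + 1) with h2 | ⟨h2, h2'⟩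
        · have h3 : s ∉ S := fun h3 => by
            rw [if_pos h3] at h1
            have := hI.2 s
            omega
          rw [if_neg h3] at h1
          exact ⟨s, ⟨by omega, h3⟩, rfl, by omega⟩
        · exact ⟨s + 1, ⟨by omega, h2'⟩, rfl, by omega⟩

open Classical in
theorem tilingCount_dentedStrip (hn : 1 ≤ n) (hS : S ⊆ Icc 1 n) (hZ : Z ⊆ Icc 1 (n - 1)) :
    tilingCount (dentedStrip h n S Z) = if Interlaces S Z then 1 else 0 := by
  unfold tilingCount
  split_ifs with hI
  · rw [card_eq_one]
    refine ⟨_, eq_singleton_iff_unique_mem.2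
      ⟨mem_lozengeTilings.2 (isLozengeTiling_dentedStrip hS hZ hI), fun T hT => ?_⟩⟩
    exact tiling_eq_image hS hZ (mem_lozengeTilings.1 hT)
  · rw [card_eq_zero, eq_empty_iff_forall_notMem]
    exact fun T hT => hI (interlaces_of_tiling hn hS hZ (mem_lozengeTilings.1 hT))

end strip

/-! ### Tilings of the upper half of the hexagon -/

theorem up_mem_hexagon {a b : ℕ} {y s : ℤ} : up y s ∈ hexagon a b b ↔
    y < b ∧ s + y ≤ a + b ∧ s ≤ a + b ∧ -(b : ℤ) ≤ y ∧ 1 ≤ s + y ∧ 1 ≤ s := by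
  simp only [mem_hexagon, up, UnitTriangle.vertices, if_true, mem_insert, mem_singleton,
    forall_eq_or_imp, forall_eq, InHexagon]
  omega

theorem down_mem_hexagon {a b : ℕ} {y s : ℤ} : down y s ∈ hexagon a b b ↔
    y ≤ b ∧ s + y ≤ a + b ∧ s ≤ a + b ∧ -(b : ℤ) < y ∧ 1 ≤ s + y ∧ 1 ≤ s := by
  simp only [mem_hexagon, down, UnitTriangle.vertices, Bool.false_eq_true, if_false, mem_insert,
    mem_singleton, forall_eq_or_imp, forall_eq, InHexagon]
  omega

/-- The part above the line `y = h` of the hexagon, with the up-pointing triangles with bases on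
this line and labels in `S` removed. -/
noncomputable def dentedTrapezoid (a b : ℕ) (h : ℤ) (S : Finset ℤ) : Region :=
  above h (hexagon a b b) \ S.image (up h)

section trapezoid

variable {a b : ℕ} {h : ℤ} {S Z : Finset ℤ}

theorem up_mem_dentedTrapezoid {y s : ℤ} : up y s ∈ dentedTrapezoid a b h S ↔
    up y s ∈ hexagon a b b ∧ h ≤ y ∧ ¬(y = h ∧ s ∈ S) := by
  simp only [dentedTrapezoid, above, mem_sdiff, mem_filter, isAbove_up, mem_image, up_inj,
    and_assoc]
  grind

theorem down_mem_dentedTrapezoid {y s : ℤ} : down y s ∈ dentedTrapezoid a b h S ↔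
    down y s ∈ hexagon a b b ∧ h < y := by
  simp [dentedTrapezoid, above]

theorem above_dentedTrapezoid (Z : Finset ℤ) :
    above (h + 1) (dentedTrapezoid a b h S) \ Z.image (up (h + 1)) =
      dentedTrapezoid a b (h + 1) Z := by
  ext t
  simp only [dentedTrapezoid, above, mem_sdiff, mem_filter, mem_image]
  rcases up_or_down t with ⟨y, s, rfl⟩ | ⟨y, s, rfl⟩
  · simp only [isAbove_up, up_inj]
    grind
  · simp only [isAbove_down, up_ne_down, and_false, exists_false]
    grind

theorem below_dentedTrapezoid (h0 : 0 ≤ h) (hb : h < b) (Z : Finset ℤ) :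
    below (h + 1) (dentedTrapezoid a b h S) \ Z.image (down (h + 1)) =
      dentedStrip h (a + b - h) S Z := by
  ext t
  simp only [below, mem_sdiff, mem_filter, mem_image]
  rcases up_or_down t with ⟨y, s, rfl⟩ | ⟨y, s, rfl⟩
  · simp only [isAbove_up, down_ne_up, and_false, exists_false, up_mem_dentedTrapezoid,
      up_mem_dentedStrip, up_mem_hexagon]
    grind
  · simp only [isAbove_down, down_inj, down_mem_dentedTrapezoid, down_mem_dentedStrip,
      down_mem_hexagon]
    grind

theorem tilingCount_empty : tilingCount ∅ = 1 := by
  unfold tilingCount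
  rw [card_eq_one]
  refine ⟨∅, eq_singleton_iff_unique_mem.2 ⟨mem_lozengeTilings.2 ⟨by simp, by simp, by simp⟩,
    fun T hT => ?_⟩⟩
  rw [mem_lozengeTilings] at hT
  rw [eq_empty_iff_forall_notMem]
  intro L hL
  exact (hT.lozenge L hL).nonempty.ne_empty (subset_empty.1 (hT.subset hL))

/-- Here m is the height of the trapezoid. Cutting off its bottom strip gives a trapezoid of height
m − 1 whose dents are the crossings, which must interlace with S. -/
theorem tilingCount_dentedTrapezoid (m : ℕ) : ∀ {h : ℤ} {S : Finset ℤ}, 0 ≤ h → h + m = b →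
    (∀ s ∈ S, up h s ∈ hexagon a b b) →
    ((∏ i ∈ range m, i.factorial : ℕ) : ℤ) * tilingCount (dentedTrapezoid a b h S) =
      if S.card = m then delta S else 0 := by
  induction m with
  | zero =>
    intro h S h0 hb hS
    obtain rfl : S = ∅ := by
      rw [eq_empty_iff_forall_notMem]
      intro s hs
      have := up_mem_hexagon.1 (hS s hs)
      omega
    have e : dentedTrapezoid a b h ∅ = ∅ := by
      rw [eq_empty_iff_forall_notMem]
      intro t
      rcases up_or_down t with ⟨y, s, rfl⟩ | ⟨y, s, rfl⟩
      · rw [up_mem_dentedTrapezoid, up_mem_hexagon]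
        omega
      · rw [down_mem_dentedTrapezoid, down_mem_hexagon]
        omega
    rw [e, tilingCount_empty]
    simp [delta]
  | succ m ih =>
    intro h S h0 hb hS
    classical
    push_cast at hb
    have hS' : S ⊆ Icc 1 ((a : ℤ) + b - h) := fun s hs => by
      have := up_mem_hexagon.1 (hS s hs)
      rw [mem_Icc]
      omega
    rw [prod_range_succ, tilingCount_eq_sum (h + 1)]
    set F := crossable (h + 1) (dentedTrapezoid a b h S) with hF
    have hFm : ∀ z ∈ F, (1 ≤ z ∧ z ≤ (a : ℤ) + b - h - 1) ∧ up (h + 1) z ∈ hexagon a b b := by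
      intro z hz
      rw [hF, mem_crossable, up_mem_dentedTrapezoid] at hz
      have := up_mem_hexagon.1 hz.1.1
      exact ⟨by omega, hz.1.1⟩
    have hterm : ∀ Z ∈ F.powerset, (((∏ i ∈ range m, i.factorial : ℕ) : ℤ) *
        ((tilingCount (above (h + 1) (dentedTrapezoid a b h S) \ Z.image (up (h + 1))) *
          tilingCount (below (h + 1) (dentedTrapezoid a b h S) \ Z.image (down (h + 1))) :
            ℕ) : ℤ)) =
        if S.card = m + 1 then (if Interlaces S Z then delta Z else 0) else 0 := by
      intro Z hZ
      rw [mem_powerset] at hZ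
      rw [above_dentedTrapezoid, below_dentedTrapezoid h0 (by omega),
        tilingCount_dentedStrip (by omega) hS' fun z hz => mem_Icc.2 (hFm z (hZ hz)).1]
      push_cast
      have := ih (h := h + 1) (S := Z) (by omega) (by omega) fun z hz => (hFm z (hZ hz)).2
      push_cast at this
      rw [← mul_assoc, this]
      -- Interlacing gives |S| = |Z| + 1, so the condition |Z| = m of the induction hypothesis
      -- becomes |S| = m + 1.
      by_cases hI : Interlaces S Z
      · have := hI.1
        simp only [hI, if_true, mul_one]
        congr 1
        rw [eq_iff_iff]
        omega
      · simp [hI]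
    push_cast
    push_cast at hterm
    rw [mul_comm (∏ i ∈ range m, (i.factorial : ℤ)), mul_assoc, mul_sum, sum_congr rfl hterm]
    by_cases hc : S.card = m + 1
    · simp only [hc, if_true]
      refine sum_delta_interlaces hc fun Z hI => mem_powerset.2 fun z hz => ?_
      obtain ⟨⟨s, hs, hsz⟩, s', hs', hzs⟩ := hI.exists_le_lt hz
      have h1 := mem_Icc.1 (hS' hs)
      have h2 := mem_Icc.1 (hS' hs')
      -- No segment of the top side can be crossed, so h + 1 < b is needed. It holds because |Z| = m
      -- and Z is nonempty.
      have h3 : 0 < Z.card := card_pos.2 ⟨z, hz⟩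
      have h4 := hI.1
      rw [hF, mem_crossable, up_mem_dentedTrapezoid, down_mem_dentedTrapezoid, up_mem_hexagon,
        down_mem_hexagon]
      omega
    · simp [hc]

end trapezoid

/-! ### Rotation by 180° -/

theorem rotate_rotate (o : LatticePoint) (t : UnitTriangle) : (t.rotate o).rotate o = t := by
  obtain ⟨x, y, u⟩ := t
  simp [UnitTriangle.rotate]
  ring

theorem rotate_injective (o : LatticePoint) : Function.Injective (UnitTriangle.rotate o) :=
  Function.LeftInverse.injective (rotate_rotate o)

theorem UnitTriangle.Adj.rotate {s t : UnitTriangle} (h : s.Adj t) (o : LatticePoint) :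
    (s.rotate o).Adj (t.rotate o) := by
  have hi : Function.Injective (rotatePoint o) := fun p q e => by
    simpa [rotatePoint] using e
  refine ⟨fun e => h.1 (rotate_injective o e), ?_⟩
  rw [vertices_rotate, vertices_rotate, ← image_inter _ _ hi, card_image_of_injective _ hi]
  exact h.2

/-- The image of a region under rotation. -/
def rotateRegion (o : LatticePoint) (G : Region) : Region := G.image (UnitTriangle.rotate o)

/-- The image of a tiling under rotation. -/
def rotateTiling (o : LatticePoint) (T : Finset Region) : Finset Region :=
  T.image (rotateRegion o)

theorem mem_rotateRegion {o : LatticePoint} {G : Region} {t : UnitTriangle} :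
    t ∈ rotateRegion o G ↔ t.rotate o ∈ G := by
  unfold rotateRegion
  rw [mem_image]
  constructor
  · rintro ⟨s, hs, rfl⟩
    rwa [rotate_rotate]
  · exact fun h => ⟨_, h, rotate_rotate o t⟩

theorem rotateRegion_rotateRegion (o : LatticePoint) (G : Region) :
    rotateRegion o (rotateRegion o G) = G := by
  ext t
  rw [mem_rotateRegion, mem_rotateRegion, rotate_rotate]

theorem rotateTiling_rotateTiling (o : LatticePoint) (T : Finset Region) :
    rotateTiling o (rotateTiling o T) = T := by
  simp [rotateTiling, image_image, Function.comp_def, rotateRegion_rotateRegion]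

theorem IsLozenge.rotate {L : Region} (hL : IsLozenge L) (o : LatticePoint) :
    IsLozenge (rotateRegion o L) := by
  obtain ⟨s, t, hst, rfl⟩ := hL
  exact ⟨_, _, hst.rotate o, by simp [rotateRegion, image_insert]⟩

theorem IsLozengeTiling.rotate {G : Region} {T : Finset Region} (hT : IsLozengeTiling G T)
    (o : LatticePoint) : IsLozengeTiling (rotateRegion o G) (rotateTiling o T) where
  lozenge L hL := by
    obtain ⟨L, h, rfl⟩ := mem_image.1 hL
    exact (hT.lozenge L h).rotate o
  disjoint L hL L' hL' hne := by
    obtain ⟨L, h, rfl⟩ := mem_image.1 hL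
    obtain ⟨L', h', rfl⟩ := mem_image.1 hL'
    exact (disjoint_image (rotate_injective o)).2
      (hT.disjoint L h L' h' fun e => hne (congrArg _ e))
  cover := by
    ext t
    rw [mem_rotateRegion, ← hT.cover]
    simp [rotateTiling, mem_rotateRegion]

theorem tilingCount_rotateRegion (o : LatticePoint) (G : Region) :
    tilingCount (rotateRegion o G) = tilingCount G := by
  unfold tilingCount
  refine card_nbij' (rotateTiling o) (rotateTiling o) ?_ ?_
    (fun T _ => rotateTiling_rotateTiling o T) (fun T _ => rotateTiling_rotateTiling o T)
  · intro T hT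
    rw [mem_coe, mem_lozengeTilings] at hT ⊢
    simpa only [rotateRegion_rotateRegion] using hT.rotate o
  · intro T hT
    rw [mem_coe, mem_lozengeTilings] at hT ⊢
    exact hT.rotate o

theorem isCentrallySymmetric_iff {o : LatticePoint} {G : Region} :
    IsCentrallySymmetric o G ↔ rotateRegion o G = G := Iff.rfl

theorem isCentrallySymmetricTiling_iff {o : LatticePoint} {T : Finset Region} :
    IsCentrallySymmetricTiling o T ↔ rotateTiling o T = T := Iff.rfl

section halves

variable {a b : ℕ}

theorem rotate_up (y s : ℤ) :
    (up y s).rotate (twiceCenter a b) = down (-y) (((a + b : ℕ) : ℤ) + 1 - s) := by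
  simp only [up, down, UnitTriangle.rotate, twiceCenter, UnitTriangle.mk.injEq, Bool.not_true,
    and_true]
  push_cast
  omega

theorem rotate_down (y s : ℤ) :
    (down y s).rotate (twiceCenter a b) = up (-y) (((a + b : ℕ) : ℤ) + 1 - s) := by
  simp only [up, down, UnitTriangle.rotate, twiceCenter, UnitTriangle.mk.injEq, Bool.not_false,
    and_true]
  push_cast
  omega

/-- The center lies on the line y = 0, so the rotation exchanges the two halves. -/
theorem isAbove_rotate {t : UnitTriangle} :
    IsAbove 0 (t.rotate (twiceCenter a b)) ↔ ¬IsAbove 0 t := by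
  rcases up_or_down t with ⟨y, s, rfl⟩ | ⟨y, s, rfl⟩
  · rw [rotate_up, isAbove_up, isAbove_down]
    omega
  · rw [rotate_down, isAbove_up, isAbove_down]
    omega

theorem mem_reflect {k : ℕ} {X : Finset ℤ} {x : ℤ} : x ∈ reflect k X ↔ (k : ℤ) + 1 - x ∈ X := by
  unfold reflect
  rw [mem_image]
  constructor
  · rintro ⟨y, hy, rfl⟩
    simpa using hy
  · exact fun h => ⟨_, h, by ring⟩

theorem reflect_reflect (k : ℕ) (X : Finset ℤ) : reflect k (reflect k X) = X := by
  ext x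
  simp [mem_reflect]

theorem rotateRegion_vert (s : ℤ) : rotateRegion (twiceCenter a b) (vert 0 s) =
    vert 0 (((a + b : ℕ) : ℤ) + 1 - s) := by
  rw [rotateRegion, vert, image_insert, image_singleton, rotate_up, rotate_down, neg_zero,
    pair_comm, vert]

theorem rotateRegion_above {G : Region} (hG : IsCentrallySymmetric (twiceCenter a b) G)
    (Z : Finset ℤ) :
    rotateRegion (twiceCenter a b) (above 0 G \ Z.image (up 0)) =
      below 0 G \ (reflect (a + b) Z).image (down 0) := by
  have hG' : ∀ t, t.rotate (twiceCenter a b) ∈ G ↔ t ∈ G := fun t => by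
    rw [← mem_rotateRegion, isCentrallySymmetric_iff.1 hG]
  ext t
  simp only [mem_rotateRegion, above, below, mem_sdiff, mem_filter, hG', isAbove_rotate,
    mem_image, mem_reflect]
  rcases up_or_down t with ⟨y, s, rfl⟩ | ⟨y, s, rfl⟩
  · simp [rotate_up]
  · simp only [rotate_down, up_inj, down_inj]
    grind

theorem crossings_rotateTiling (T : Finset Region) :
    crossings 0 (rotateTiling (twiceCenter a b) T) = reflect (a + b) (crossings 0 T) := by
  ext s
  rw [mem_reflect, mem_crossings, mem_crossings, ← rotateRegion_vert, rotateTiling, mem_image]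
  constructor
  · rintro ⟨L, hL, e⟩
    rwa [← e, rotateRegion_rotateRegion]
  · exact fun h => ⟨_, h, rotateRegion_rotateRegion _ _⟩

theorem tilesBelow_rotateTiling (T : Finset Region) :
    tilesBelow 0 (rotateTiling (twiceCenter a b) T) =
      rotateTiling (twiceCenter a b) (tilesAbove 0 T) := by
  unfold tilesBelow tilesAbove rotateTiling
  rw [filter_image]
  congr 1
  refine filter_congr fun L _ => ?_
  simp [rotateRegion, isAbove_rotate]

theorem rotateTiling_glue (Z : Finset ℤ) (T₁ T₂ : Finset Region) :
    rotateTiling (twiceCenter a b) (glue 0 Z T₁ T₂) =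
      glue 0 (reflect (a + b) Z) (rotateTiling (twiceCenter a b) T₂)
        (rotateTiling (twiceCenter a b) T₁) := by
  unfold glue rotateTiling reflect
  rw [image_union, image_union, union_comm (T₁.image _), image_image, image_image]
  congr 2
  funext s
  exact rotateRegion_vert s

/-- The lower part of an invariant tiling is the rotated upper part, and its crossings form an
invariant set. Conversely, any tiling of the upper part extends in this way when Z is invariant. -/
theorem symmetricTilingCount_eq_sum {G : Region}
    (hG : IsCentrallySymmetric (twiceCenter a b) G) :
    symmetricTilingCount (twiceCenter a b) G =
      ∑ Z ∈ (crossable 0 G).powerset.filter (fun Z => reflect (a + b) Z = Z),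
        tilingCount (above 0 G \ Z.image (up 0)) := by
  classical
  unfold symmetricTilingCount
  rw [card_eq_sum_card_fiberwise (f := crossings 0)
    (t := (crossable 0 G).powerset.filter (fun Z => reflect (a + b) Z = Z))]
  · refine sum_congr rfl fun Z hZ => ?_
    obtain ⟨hZG, hZr⟩ := mem_filter.1 hZ
    rw [mem_powerset] at hZG
    have hrot : ∀ {T₁}, IsLozengeTiling (above 0 G \ Z.image (up 0)) T₁ →
        IsLozengeTiling (below 0 G \ Z.image (down 0)) (rotateTiling (twiceCenter a b) T₁) :=
      fun h => by
        have := h.rotate (twiceCenter a b)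
        rwa [rotateRegion_above hG, hZr] at this
    refine card_nbij' (tilesAbove 0) (fun T₁ => glue 0 Z T₁ (rotateTiling (twiceCenter a b) T₁))
      ?_ ?_ ?_ ?_
    · intro T hT'
      obtain ⟨hT, rfl⟩ := mem_filter.1 (mem_coe.1 hT')
      exact mem_coe.2 (mem_lozengeTilings.2
        ((mem_lozengeTilings.1 (mem_filter.1 hT).1).restrict_above 0))
    · intro T₁ hT
      rw [mem_coe, mem_lozengeTilings] at hT
      refine mem_coe.2 (mem_filter.2 ⟨mem_filter.2 ⟨mem_lozengeTilings.2
        (isLozengeTiling_glue hZG hT (hrot hT)), ?_⟩, crossings_glue hT (hrot hT)⟩)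
      rw [isCentrallySymmetricTiling_iff, rotateTiling_glue, rotateTiling_rotateTiling, hZr]
    · intro T hT'
      obtain ⟨hT, rfl⟩ := mem_filter.1 (mem_coe.1 hT')
      obtain ⟨hT, hs⟩ := mem_filter.1 hT
      have := tilesBelow_rotateTiling (a := a) (b := b) T
      rw [isCentrallySymmetricTiling_iff.1 hs] at this
      simp only
      rw [← this]
      exact (mem_lozengeTilings.1 hT).glue_eq 0
    · intro T₁ hT
      rw [mem_coe, mem_lozengeTilings] at hT
      exact tilesAbove_glue hT (hrot hT)
  · intro T hT
    obtain ⟨hT, hs⟩ := mem_filter.1 (mem_coe.1 hT)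
    refine mem_coe.2 (mem_filter.2 ⟨mem_powerset.2
      ((mem_lozengeTilings.1 hT).crossings_subset 0), ?_⟩)
    rw [← crossings_rotateTiling, isCentrallySymmetricTiling_iff.1 hs]

/-- Rotating the lower part expresses both factors through the upper half, at the price of
reflecting Z in one of them. -/
theorem tilingCount_eq_sum_of_isCentrallySymmetric {G : Region}
    (hG : IsCentrallySymmetric (twiceCenter a b) G) :
    tilingCount G = ∑ Z ∈ (crossable 0 G).powerset,
      tilingCount (above 0 G \ Z.image (up 0)) *
        tilingCount (above 0 G \ (reflect (a + b) Z).image (up 0)) := by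
  rw [tilingCount_eq_sum 0]
  refine sum_congr rfl fun Z _ => ?_
  rw [← tilingCount_rotateRegion (twiceCenter a b) (above 0 G \ (reflect (a + b) Z).image _),
    rotateRegion_above hG, reflect_reflect]

end halves

/-! ### The product of differences of a union -/

theorem delta_eq_prod_ite (S : Finset ℤ) :
    delta S = ∏ p ∈ S, ∏ q ∈ S, if p < q then q - p else 1 := by
  simp_rw [delta, prod_filter, prod_product]

/-- The product of the distances between `x` and the elements of `Z`. -/
def distProd (Z : Finset ℤ) (x : ℤ) : ℤ := ∏ z ∈ Z, |x - z|

theorem delta_insert {S : Finset ℤ} {x : ℤ} (hx : x ∉ S) :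
    delta (insert x S) = delta S * distProd S x := by
  have e : distProd S x =
      (∏ q ∈ S, if x < q then q - x else 1) * ∏ p ∈ S, if p < x then x - p else 1 := by
    rw [distProd, ← prod_mul_distrib]
    refine prod_congr rfl fun z hz => ?_
    have : x ≠ z := by rintro rfl; exact hx hz
    rcases lt_or_gt_of_ne this with h | h
    · rw [if_pos h, if_neg h.not_gt, mul_one, abs_sub_comm, abs_of_pos (sub_pos.2 h)]
    · rw [if_pos h, if_neg h.not_gt, one_mul, abs_of_pos (sub_pos.2 h)]
  rw [delta_eq_prod_ite, delta_eq_prod_ite, prod_insert hx, prod_insert hx, e]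
  simp_rw [prod_insert hx, prod_mul_distrib]
  simp only [lt_self_iff_false, if_false]
  ring

theorem distProd_union {A B : Finset ℤ} (h : Disjoint A B) (x : ℤ) :
    distProd (A ∪ B) x = distProd A x * distProd B x := prod_union h

theorem delta_union {A B : Finset ℤ} (h : Disjoint A B) :
    delta (A ∪ B) = delta A * delta B * ∏ x ∈ A, distProd B x := by
  induction A using Finset.induction_on with
  | empty => simp [delta]
  | insert x A hx ih =>
    rw [disjoint_insert_left] at h
    rw [insert_union, delta_insert (by simp [hx, h.1]), ih h.2, delta_insert hx,
      prod_insert hx, distProd_union h.2]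
    ring

theorem reflect_injective (k : ℕ) : Function.Injective (fun x : ℤ => (k : ℤ) + 1 - x) :=
  fun _ _ e => sub_right_injective e

theorem card_reflect (k : ℕ) (X : Finset ℤ) : (reflect k X).card = X.card :=
  card_image_of_injective _ (reflect_injective k)

theorem reflect_union (k : ℕ) (X Y : Finset ℤ) :
    reflect k (X ∪ Y) = reflect k X ∪ reflect k Y := image_union _ _

/-- Reflection reverses the order and preserves distances. -/
theorem delta_reflect (k : ℕ) (X : Finset ℤ) : delta (reflect k X) = delta X := by
  rw [delta_eq_prod_ite, delta_eq_prod_ite, reflect, prod_image (reflect_injective k).injOn]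
  simp only [prod_image (reflect_injective k).injOn]
  rw [prod_comm]
  refine prod_congr rfl fun p _ => ?_
  refine prod_congr rfl fun q _ => ?_
  split_ifs <;> omega

theorem distProd_pos {Z : Finset ℤ} {x : ℤ} (hx : x ∉ Z) : 0 < distProd Z x :=
  prod_pos fun z hz => abs_pos.2 fun e => hx (by rwa [sub_eq_zero.1 e])

theorem distProd_reflect {k : ℕ} {Z : Finset ℤ} (hZ : reflect k Z = Z) (x : ℤ) :
    distProd Z ((k : ℤ) + 1 - x) = distProd Z x := by
  conv_lhs => rw [← hZ]
  rw [distProd, reflect, prod_image (reflect_injective k).injOn, distProd]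
  refine prod_congr rfl fun z _ => ?_
  rw [← abs_neg]
  congr 1
  ring

theorem prod_reflect_distProd {k : ℕ} {Z : Finset ℤ} (hZ : reflect k Z = Z) (X : Finset ℤ) :
    ∏ x ∈ reflect k X, distProd Z x = ∏ x ∈ X, distProd Z x := by
  rw [reflect, prod_image (reflect_injective k).injOn]
  exact prod_congr rfl fun x _ => distProd_reflect hZ x

/-! ### Enumeration of the tilings of the symmetric region -/

/-- The labels not in `U` of the segments on the horizontal diagonal which may be crossed by
lozenges. -/
noncomputable def freeLabels (a b : ℕ) (U : Finset ℤ) : Finset ℤ :=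
  crossable 0 (hexagon a b b) \ U

/-- The number of tilings of the upper half of the hexagon with `b` dents times this number is the
product of differences of the dents. -/
def halfFactor (b : ℕ) : ℕ := ∏ i ∈ range b, i.factorial

theorem halfFactor_pos (b : ℕ) : 0 < halfFactor b := prod_pos fun i _ => i.factorial_pos

section count

variable {a b : ℕ} {X : Finset ℤ}

theorem mem_crossable_hexagon {s : ℤ} :
    s ∈ crossable 0 (hexagon a b b) ↔ 0 < b ∧ s ∈ labels (a + b) := by
  rw [mem_crossable, up_mem_hexagon, down_mem_hexagon, labels, mem_Icc]
  push_cast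
  omega

theorem up_mem_symmetricRegion {s y : ℤ} : up y s ∈ symmetricRegion a b X ↔
    up y s ∈ hexagon a b b ∧ ¬(y = 0 ∧ s ∈ X) := by
  have : ∀ x, upAt x = up 0 x := fun _ => rfl
  have : ∀ x, downAt x = down 0 x := fun _ => rfl
  simp only [symmetricRegion, dentedHexagon, mem_sdiff, mem_union, mem_image, *, up_inj,
    down_ne_up, and_false, exists_false, or_false]
  grind

theorem down_mem_symmetricRegion {s y : ℤ} : down y s ∈ symmetricRegion a b X ↔
    down y s ∈ hexagon a b b ∧ ¬(y = 0 ∧ s ∈ reflect (a + b) X) := by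
  have : ∀ x, upAt x = up 0 x := fun _ => rfl
  have : ∀ x, downAt x = down 0 x := fun _ => rfl
  simp only [symmetricRegion, dentedHexagon, mem_sdiff, mem_union, mem_image, *, down_inj,
    up_ne_down, and_false, exists_false, false_or]
  grind

theorem crossable_symmetricRegion :
    crossable 0 (symmetricRegion a b X) = freeLabels a b (X ∪ reflect (a + b) X) := by
  ext s
  simp only [freeLabels, mem_sdiff, mem_crossable, up_mem_symmetricRegion,
    down_mem_symmetricRegion, mem_union]
  tauto

theorem above_symmetricRegion (Z : Finset ℤ) :
    above 0 (symmetricRegion a b X) \ Z.image (up 0) = dentedTrapezoid a b 0 (X ∪ Z) := by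
  ext t
  simp only [above, mem_sdiff, mem_filter, mem_image]
  rcases up_or_down t with ⟨y, s, rfl⟩ | ⟨y, s, rfl⟩
  · simp only [isAbove_up, up_mem_symmetricRegion, up_mem_dentedTrapezoid, up_inj, mem_union]
    grind
  · simp only [isAbove_down, down_mem_symmetricRegion, down_mem_dentedTrapezoid, up_ne_down,
      and_false, exists_false]
    grind

theorem up_mem_hexagon_of_mem (hX : X ⊆ labels (a + b)) (hb : X.card ≤ b) {s : ℤ} (hs : s ∈ X) :
    up 0 s ∈ hexagon a b b := by
  have h1 := mem_Icc.1 (hX hs)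
  have h2 : 0 < X.card := card_pos.2 ⟨s, hs⟩
  rw [up_mem_hexagon]
  push_cast at h1
  omega

theorem halfFactor_mul_tilingCount (hX : X ⊆ labels (a + b)) (hb : X.card ≤ b) {Z : Finset ℤ}
    (hZ : Z ⊆ freeLabels a b (X ∪ reflect (a + b) X)) :
    (halfFactor b : ℤ) * tilingCount (above 0 (symmetricRegion a b X) \ Z.image (up 0)) =
      if X.card + Z.card = b then delta X * delta Z * ∏ x ∈ X, distProd Z x else 0 := by
  have hd : Disjoint X Z := disjoint_left.2 fun x hx hz =>
    (mem_sdiff.1 (hZ hz)).2 (mem_union_left _ hx)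
  rw [above_symmetricRegion, halfFactor, tilingCount_dentedTrapezoid b le_rfl (zero_add _) ?_,
    card_union_of_disjoint hd, delta_union hd]
  intro s hs
  rcases mem_union.1 hs with hs | hs
  · exact up_mem_hexagon_of_mem hX hb hs
  · exact (mem_crossable.1 (mem_sdiff.1 (hZ hs)).1).1

theorem reflect_subset_freeLabels {Z : Finset ℤ}
    (hZ : Z ⊆ freeLabels a b (X ∪ reflect (a + b) X)) :
    reflect (a + b) Z ⊆ freeLabels a b (X ∪ reflect (a + b) X) := by
  intro x hx
  have := hZ (mem_reflect.1 hx)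
  rw [freeLabels, mem_sdiff, mem_crossable_hexagon, mem_union, mem_reflect, labels, mem_Icc]
    at this ⊢
  rw [sub_sub_cancel] at this
  exact ⟨by omega, by tauto⟩

/-- Both sides are Δ₁ of a disjoint union, and reflection maps X ∪ Z_(k) to X_(k) ∪ Z. This moves
the reflection from the summation variable Z to the fixed set X. -/
theorem delta_mul_prod_reflect {Z : Finset ℤ}
    (hZ : Z ⊆ freeLabels a b (X ∪ reflect (a + b) X)) :
    delta X * delta (reflect (a + b) Z) * ∏ x ∈ X, distProd (reflect (a + b) Z) x =
      delta X * delta Z * ∏ x ∈ reflect (a + b) X, distProd Z x := by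
  have h1 : Disjoint X (reflect (a + b) Z) := disjoint_left.2 fun x hx hz =>
    (mem_sdiff.1 (reflect_subset_freeLabels hZ hz)).2 (mem_union_left _ hx)
  have h2 : Disjoint (reflect (a + b) X) Z := disjoint_left.2 fun x hx hz =>
    (mem_sdiff.1 (hZ hz)).2 (mem_union_right _ hx)
  rw [← delta_union h1, ← delta_reflect (a + b) (X ∪ _), reflect_union, reflect_reflect,
    delta_union h2, delta_reflect]

/-- The factor of the number of tilings of `V(X)` which depends only on the size of `X` and on the
union `U` and the intersection `I` of `X` and its reflection. -/
noncomputable def commonFactor (a b n : ℕ) (U I : Finset ℤ) : ℤ :=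
  ∑ Z ∈ (freeLabels a b U).powerset, if n + Z.card = b then
    delta Z ^ 2 * ((∏ x ∈ U, distProd Z x) * ∏ x ∈ I, distProd Z x) else 0

/-- The products of distances from Z over X and over X_(k) combine to those over the union and the
intersection, leaving Δ₁(X)² as the only other dependence on X. -/
theorem tilingCount_symmetricRegion (hX : X ⊆ labels (a + b)) (hb : X.card ≤ b) :
    (halfFactor b : ℤ) ^ 2 * tilingCount (symmetricRegion a b X) =
      delta X ^ 2 * commonFactor a b X.card (X ∪ reflect (a + b) X) (X ∩ reflect (a + b) X) := by
  rw [tilingCount_eq_sum_of_isCentrallySymmetric (symmetricRegion_isCentrallySymmetric a b X),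
    crossable_symmetricRegion, commonFactor, mul_sum]
  push_cast
  rw [mul_sum]
  refine sum_congr rfl fun Z hZ => ?_
  rw [mem_powerset] at hZ
  rw [sq, mul_mul_mul_comm, halfFactor_mul_tilingCount hX hb hZ,
    halfFactor_mul_tilingCount hX hb (reflect_subset_freeLabels hZ), card_reflect,
    delta_mul_prod_reflect hZ, prod_union_inter]
  split_ifs <;> ring

theorem commonFactor_pos {n : ℕ} {U I : Finset ℤ} (hI : I ⊆ U)
    (hb : n ≤ b) (hcard : b ≤ n + (labels (a + b) \ U).card) : 0 < commonFactor a b n U I := by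
  have hterm : ∀ Z ∈ (freeLabels a b U).powerset,
      0 < delta Z ^ 2 * ((∏ x ∈ U, distProd Z x) * ∏ x ∈ I, distProd Z x) := by
    intro Z hZ
    have h : ∀ x ∈ U, 0 < distProd Z x := fun x hx => distProd_pos fun hxZ =>
      (mem_sdiff.1 (mem_powerset.1 hZ hxZ)).2 hx
    exact mul_pos (pow_pos (delta_pos Z) 2)
      (mul_pos (prod_pos h) (prod_pos fun x hx => h x (hI hx)))
  have hfree : b - n ≤ (freeLabels a b U).card := by
    -- For b = 0 the hexagon is degenerate and no segment is crossable, but then no crossing is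
    -- required either.
    rcases Nat.eq_zero_or_pos b with rfl | hb0
    · simp
    · have : labels (a + b) = crossable 0 (hexagon a b b) := by
        ext s
        rw [mem_crossable_hexagon]
        tauto
      rw [freeLabels, ← this]
      omega
  obtain ⟨Z, hZ, hZc⟩ := exists_subset_card_eq hfree
  refine sum_pos' (fun Z hZ => ?_) ⟨Z, mem_powerset.2 hZ, ?_⟩
  · split_ifs
    exacts [(hterm Z hZ).le, le_rfl]
  · rw [if_pos (by omega)]
    exact hterm Z (mem_powerset.2 hZ)

/-- The number of centrally symmetric tilings of `V(X)`, up to the factors `halfFactor b` and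
`delta X`. -/
noncomputable def symmetricFactor (a b : ℕ) (X : Finset ℤ) : ℤ :=
  ∑ Z ∈ (freeLabels a b (X ∪ reflect (a + b) X)).powerset.filter (fun Z => reflect (a + b) Z = Z),
    if X.card + Z.card = b then delta Z * ∏ x ∈ X, distProd Z x else 0

theorem symmetricTilingCount_symmetricRegion (hX : X ⊆ labels (a + b)) (hb : X.card ≤ b) :
    (halfFactor b : ℤ) * symmetricTilingCount (twiceCenter a b) (symmetricRegion a b X) =
      delta X * symmetricFactor a b X := by
  rw [symmetricTilingCount_eq_sum (symmetricRegion_isCentrallySymmetric a b X),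
    crossable_symmetricRegion, symmetricFactor, mul_sum]
  push_cast
  rw [mul_sum]
  refine sum_congr rfl fun Z hZ => ?_
  rw [halfFactor_mul_tilingCount hX hb (mem_powerset.1 (mem_filter.1 hZ).1)]
  split_ifs <;> ring

end count

/-! ### Quantities preserved by shuffling -/

section shuffling

variable {k : ℕ} {X X' : Finset ℤ}

theorem IsShuffling.card_eq (h : IsShuffling X' (reflect k X') X (reflect k X)) :
    X'.card = X.card := by
  have h1 := card_union_add_card_inter X (reflect k X)
  have h2 := card_union_add_card_inter X' (reflect k X')
  rw [h.1, h.2, card_reflect] at h1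
  rw [card_reflect] at h2
  omega

/-- For invariant Z the square of the product is the product over the union times that over the
intersection. Both are shuffling invariants, and the products are nonnegative. -/
theorem IsShuffling.prod_distProd_eq (h : IsShuffling X' (reflect k X') X (reflect k X))
    {Z : Finset ℤ} (hZ : reflect k Z = Z) :
    ∏ x ∈ X', distProd Z x = ∏ x ∈ X, distProd Z x := by
  have key : ∀ Y : Finset ℤ, (∏ x ∈ Y, distProd Z x) ^ 2 =
      (∏ x ∈ Y ∪ reflect k Y, distProd Z x) * ∏ x ∈ Y ∩ reflect k Y, distProd Z x := fun Y => by
    rw [prod_union_inter, prod_reflect_distProd hZ, sq]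
  have hpos : ∀ Y : Finset ℤ, 0 ≤ ∏ x ∈ Y, distProd Z x := fun Y =>
    prod_nonneg fun x _ => prod_nonneg fun z _ => abs_nonneg _
  refine (sq_eq_sq₀ (hpos X') (hpos X)).1 ?_
  rw [key, key, h.1, h.2]

theorem IsShuffling.symmetricFactor_eq {a b : ℕ}
    (h : IsShuffling X' (reflect (a + b) X') X (reflect (a + b) X)) :
    symmetricFactor a b X' = symmetricFactor a b X := by
  unfold symmetricFactor
  rw [h.card_eq, ← h.1]
  refine sum_congr rfl fun Z hZ => ?_
  rw [h.prod_distProd_eq (mem_filter.1 hZ).2]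

theorem IsShuffling.subset_labels (h : IsShuffling X' (reflect k X') X (reflect k X))
    (hX : X ⊆ labels k) : X' ⊆ labels k := by
  intro x hx
  have : x ∈ X ∪ reflect k X := h.1 ▸ mem_union_left _ hx
  rcases mem_union.1 this with h1 | h1
  · exact hX h1
  · have := mem_Icc.1 (hX (mem_reflect.1 h1))
    rw [labels, mem_Icc]
    omega

end shuffling

end LozengeShuffling

/-! ### Comparison of the two regions -/

open LozengeShuffling
theorem theorem5p1 (a b : ℕ) (X X' : Finset ℤ)
    (hX : X ⊆ labels (a + b))
    (hb : 0 ≤ (b : ℤ) - X.card)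
    (hcard : (b : ℤ) - X.card ≤ (labels (a + b) \ (X ∪ reflect (a + b) X)).card)
    (hshuffle : IsShuffling X' (reflect (a + b) X') X (reflect (a + b) X)) :
    0 < tilingCount (symmetricRegion a b X) ∧
    √((tilingCount (symmetricRegion a b X') : ℝ) / tilingCount (symmetricRegion a b X)) =
      (delta X' : ℝ) / delta X ∧
    (symmetricTilingCount (twiceCenter a b) (symmetricRegion a b X') : ℝ) =
      (delta X' : ℝ) / delta X *
        symmetricTilingCount (twiceCenter a b) (symmetricRegion a b X) ∧
    (symmetricTilingCount (twiceCenter a b) (symmetricRegion a b X) ≠ 0 →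
      (symmetricTilingCount (twiceCenter a b) (symmetricRegion a b X') : ℝ) /
          symmetricTilingCount (twiceCenter a b) (symmetricRegion a b X) =
        √((tilingCount (symmetricRegion a b X') : ℝ) /
          tilingCount (symmetricRegion a b X))) := by
  have hX' := hshuffle.subset_labels hX
  have hc := hshuffle.card_eq
  have hb1 : X.card ≤ b := by omega
  have hb2 : X'.card ≤ b := by omega
  have hM := tilingCount_symmetricRegion hX hb1
  have hM' := tilingCount_symmetricRegion hX' hb2
  -- Size, union and intersection agree, so both counts now contain the same common factor R.
  rw [hc, ← hshuffle.1, ← hshuffle.2] at hM'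
  have hR := commonFactor_pos (a := a) (U := X ∪ reflect (a + b) X)
    (I := X ∩ reflect (a + b) X)
    (Finset.inter_subset_left.trans Finset.subset_union_left) hb1 (by omega)
  have hS := symmetricTilingCount_symmetricRegion hX hb1
  have hS' := symmetricTilingCount_symmetricRegion hX' hb2
  rw [hshuffle.symmetricFactor_eq] at hS'
  generalize commonFactor a b X.card _ _ = R at hM hM' hR
  generalize symmetricFactor a b X = Q at hS hS'
  have hd := delta_pos X
  have hd' := delta_pos X'
  have hH := halfFactor_pos b
  generalize tilingCount (symmetricRegion a b X) = M at *
  generalize tilingCount (symmetricRegion a b X') = M' at *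
  generalize symmetricTilingCount (twiceCenter a b) (symmetricRegion a b X) = N at *
  generalize symmetricTilingCount (twiceCenter a b) (symmetricRegion a b X') = N' at *
  generalize delta X = d at *
  generalize delta X' = d' at *
  generalize halfFactor b = H at *
  have hMpos : 0 < M := by
    have : 0 < (H : ℤ) ^ 2 * M := hM ▸ mul_pos (pow_pos hd 2) hR
    exact_mod_cast pos_of_mul_pos_right this (by positivity)
  replace hM : (H : ℝ) ^ 2 * M = (d : ℝ) ^ 2 * R := by exact_mod_cast hM
  replace hM' : (H : ℝ) ^ 2 * M' = (d' : ℝ) ^ 2 * R := by exact_mod_cast hM'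
  replace hS : (H : ℝ) * N = (d : ℝ) * Q := by exact_mod_cast hS
  replace hS' : (H : ℝ) * N' = (d' : ℝ) * Q := by exact_mod_cast hS'
  replace hd : (0 : ℝ) < d := by exact_mod_cast hd
  replace hd' : (0 : ℝ) < d' := by exact_mod_cast hd'
  replace hH : (0 : ℝ) < H := by exact_mod_cast hH
  have hMr : (0 : ℝ) < M := by exact_mod_cast hMpos
  have h1 : (M' : ℝ) / M = ((d' : ℝ) / d) ^ 2 := by
    rw [div_pow, div_eq_div_iff hMr.ne' (by positivity)]
    refine mul_left_cancel₀ (pow_pos hH 2).ne' ?_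
    -- This eliminates R from H²M = d²R and H²M' = d'²R.
    linear_combination (d : ℝ) ^ 2 * hM' - (d' : ℝ) ^ 2 * hM
  have h2 : √((M' : ℝ) / M) = (d' : ℝ) / d := by
    rw [h1, Real.sqrt_sq (by positivity)]
  have h3 : (N' : ℝ) = (d' : ℝ) / d * N := by
    rw [div_mul_eq_mul_div, eq_div_iff hd.ne']
    refine mul_left_cancel₀ hH.ne' ?_
    -- Eliminating Q needs no division by it, so the identity also holds when there are no symmetric
    -- tilings.
    linear_combination (d : ℝ) * hS' - (d' : ℝ) * hS
  refine ⟨hMpos, h2, h3, fun hN => ?_⟩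
  rw [h2, h3, mul_div_cancel_right₀]
  exact_mod_cast hN
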